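/- Let $\mathbb H$ be the real quaternions and let $\mathbf M=(m_{pq})$ be a square quaternion matrix of order $m$ with rows and columns indexed by a finite set $\beta$ of $m$ integers. For $i\in\beta$, the $i$-th row determinant is $$\mathrm{rdet}_i\,\mathbf M=\sum_{\sigma}(-1)^{m-s}\,m_{i\,\sigma(i)}m_{\sigma(i)\,\sigma^2(i)}\cdots m_{\sigma^{-1}(i)\,i}\;\cdot\;m_{l_2\,\sigma(l_2)}\cdots m_{\sigma^{-1}(l_2)\,l_2}\;\cdots\;m_{l_s\,\sigma(l_s)}\cdots m_{\sigma^{-1}(l_s)\,l_s},$$ where $\sigma$ runs over the permutations of $\beta$, $s$ is the number of cycles of $\sigma$ (fixed points included), and $l_2<\dots<l_s$ are the least elements of the cycles not containing $i$. The $i$-th column determinant is $$\mathrm{cdet}_i\,\mathbf M=\sum_{\tau}(-1)^{m-s}\,m_{l_s\,\tau(l_s)}\cdots m_{\tau^{-1}(l_s)\,l_s}\;\cdots\;m_{l_2\,\tau(l_2)}\cdots m_{\tau^{-1}(l_2)\,l_2}\;\cdot\;m_{i\,\tau(i)}\cdots m_{\tau^{-2}(i)\,\tau^{-1}(i)}m_{\tau^{-1}(i)\,i}.$$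 For Hermitian $\mathbf M$ all row and column determinants are equal, and their common value is $|\mathbf M|$ (with $|\mathbf M|=1$ for $m=0$). For a matrix $\mathbf M$ of order $n$ and $\beta\subseteq\{1,\dots,n\}$, let $\mathbf M_\beta^\beta$ be the principal submatrix with rows and columns indexed by $\beta$; its rows and columns keep their original indices. Let $\mathbf M_{.i}(\mathbf b)$ (resp. $\mathbf M_{j.}(\mathbf b)$) be $\mathbf M$ with its $i$-th column (resp. $j$-th row) replaced by $\mathbf b$. The rank is the maximal number of right-linearly independent columns, and $\mathrm{Ind}\,\mathbf A$ is the least $k\ge 0$ with $\operatorname{rank}\mathbf A^{k+1}=\operatorname{rank}\mathbf A^{k}$. If $\mathrm{Ind}\,\mathbf A=1$, the group inverse $\mathbf A^g$ is the unique matrix $\mathbf X$ with $\mathbf A^2\mathbf X=\mathbf A$, $\mathbf X\mathbf A\mathbf X=\mathbf X$, $\mathbf A\mathbf X=\mathbf X\mathbf A$. **Corollary 3.1.** Let $\mathbf A\in\mathbb H^{n\times n}$ be Hermitian with $\mathrm{Ind}\,\mathbf A=1$ and $\operatorname{rank}\mathbf A^2=\operatorname{rank}\mathbf A=r$. Then the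 group inverse $\mathbf A^g=(a^g_{ij})$ exists and is unique, the sum $\sum_{|\beta|=r}|(\mathbf A^2)_\beta^\beta|$ is a nonzero real number, and for all $i,j\in\{1,\dots,n\}$ $$a^g_{ij}=\frac{\displaystyle\sum_{|\beta|=r,\ i\in\beta}\mathrm{cdet}_i\Big(\big((\mathbf A^2)_{.i}(\mathbf a_{.j})\big)_\beta^\beta\Big)}{\displaystyle\sum_{|\beta|=r}\big|(\mathbf A^2)_\beta^\beta\big|} \qquad\text{and}\qquad a^g_{ij}=\frac{\displaystyle\sum_{|\alpha|=r,\ j\in\alpha}\mathrm{rdet}_j\Big(\big((\mathbf A^2)_{j.}(\mathbf a_{i.})\big)_\alpha^\alpha\Big)}{\displaystyle\sum_{|\alpha|=r}\big|(\mathbf A^2)_\alpha^\alpha\big|},$$ where $\beta$ and $\alpha$ run over subsets of $\{1,\dots,n\}$, and $\mathbf a_{.j}$, $\mathbf a_{i.}$ are the $j$-th column and $i$-th row of $\mathbf A$. -/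

import Mathlib

open scoped Quaternion Matrix

namespace QuatDet

/-- The elements that open the cycles of `σ` other than the cycle of `i`: the least element of each
such cycle (fixed points are cycles of length one), listed in increasing order. -/
def otherLeaders {ι : Type*} [Fintype ι] [LinearOrder ι] (σ : Equiv.Perm ι) (i : ι) : List ι :=
  (Finset.univ.filter
    (fun l : ι => ¬ σ.SameCycle i l ∧ ∀ m : ι, σ.SameCycle l m → l ≤ m)).sort (· ≤ ·)

/-- The list of the elements that open the cycles of `σ`: first `i`, which opens its own cycle, then
the least elements of the remaining cycles in increasing order.  Its length is the number of
cycles of `σ`, counting fixed points. -/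
def leaders {ι : Type*} [Fintype ι] [LinearOrder ι] (σ : Equiv.Perm ι) (i : ι) : List ι :=
  i :: otherLeaders σ i

/-- The number of elements in the cycle of `σ` through `l` (one for a fixed point). -/
def cycleLength {ι : Type*} [Fintype ι] [DecidableEq ι] (σ : Equiv.Perm ι) (l : ι) : ℕ :=
  (Finset.univ.filter (fun m : ι => σ.SameCycle l m)).card

/-- For the cycle `(l  σ l  σ² l  …)` opened from the left by `l`, the ordered product
`a_{l, σ l} * a_{σ l, σ² l} * … * a_{σ⁻¹ l, l}`. -/
def rowCycleProd {R : Type*} [Ring R] {ι : Type*} [Fintype ι] [DecidableEq ι]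
    (A : Matrix ι ι R) (σ : Equiv.Perm ι) (l : ι) : R :=
  ((List.range (cycleLength σ l)).map (fun t => A ((σ ^ t) l) ((σ ^ (t + 1)) l))).prod

/-- For the cycle `(…  τ⁻² l  τ⁻¹ l  l)` opened from the right by `l`, the ordered product
`a_{l, τ l} * … * a_{τ⁻² l, τ⁻¹ l} * a_{τ⁻¹ l, l}`. -/
def colCycleProd {R : Type*} [Ring R] {ι : Type*} [Fintype ι] [DecidableEq ι]
    (A : Matrix ι ι R) (τ : Equiv.Perm ι) (l : ι) : R :=
  ((List.range (cycleLength τ l)).reverse.map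
    (fun t => A ((τ⁻¹ ^ (t + 1)) l) ((τ⁻¹ ^ t) l))).prod

/-- The `i`-th row determinant: the sum over all permutations, written in left-ordered cycle
notation with `i` opening the first cycle from the left, of `(-1) ^ (n - r)` (with `r` the number
of cycles) times the product of the entries read off from left to right. -/
def rdet {R : Type*} [Ring R] {ι : Type*} [Fintype ι] [LinearOrder ι]
    (i : ι) (A : Matrix ι ι R) : R :=
  ∑ σ : Equiv.Perm ι, (-1 : R) ^ (Fintype.card ι - (leaders σ i).length) *
    ((leaders σ i).map (rowCycleProd A σ)).prod

/-- The `j`-th column determinant: the sum over all permutations, written in right-ordered cycle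
notation with `j` opening the first cycle from the right, of `(-1) ^ (n - r)` (with `r` the number
of cycles) times the product of the entries; the factor of the cycle of `j` is the rightmost. -/
def cdet {R : Type*} [Ring R] {ι : Type*} [Fintype ι] [LinearOrder ι]
    (j : ι) (A : Matrix ι ι R) : R :=
  ∑ τ : Equiv.Perm ι, (-1 : R) ^ (Fintype.card ι - (leaders τ j).length) *
    ((leaders τ j).reverse.map (colCycleProd A τ)).prod

/-- The determinant of a Hermitian matrix: the common value of its row and column determinants,
taken here at the first row; the determinant of the empty matrix is `1`. Used only for Hermitian
matrices. -/
def hdet {R : Type*} [Ring R] {ι : Type*} [Fintype ι] [LinearOrder ι] (A : Matrix ι ι R) : R :=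
  if h : (Finset.univ : Finset ι).Nonempty then rdet (Finset.univ.min' h) A else 1

/-- The principal submatrix with rows and columns indexed by `β`. -/
def principal {R : Type*} {n : ℕ} (A : Matrix (Fin n) (Fin n) R) (β : Finset (Fin n)) :
    Matrix {x : Fin n // x ∈ β} {x : Fin n // x ∈ β} R :=
  A.submatrix Subtype.val Subtype.val

/-- The sum of the principal minors of order `r` of a Hermitian matrix. -/
def sumPrincipalMinors {R : Type*} [Ring R] {n : ℕ} (r : ℕ) (A : Matrix (Fin n) (Fin n) R) : R :=
  ∑ β : {β : Finset (Fin n) // β.card = r}, hdet (principal A β.1)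

/-- The sum of the `i`-th column determinants of the principal submatrices of order `r` whose index
set contains `i`. -/
def sumCdet {R : Type*} [Ring R] {n : ℕ} (r : ℕ) (i : Fin n) (A : Matrix (Fin n) (Fin n) R) : R :=
  ∑ β : {β : Finset (Fin n) // β.card = r ∧ i ∈ β}, cdet ⟨i, β.2.2⟩ (principal A β.1)

/-- The sum of the `j`-th row determinants of the principal submatrices of order `r` whose index
set contains `j`. -/
def sumRdet {R : Type*} [Ring R] {n : ℕ} (r : ℕ) (j : Fin n) (A : Matrix (Fin n) (Fin n) R) : R :=
  ∑ α : {α : Finset (Fin n) // α.card = r ∧ j ∈ α}, rdet ⟨j, α.2.2⟩ (principal A α.1)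

/-- The rank of a quaternion matrix: the maximal number of right-linearly independent columns, i.e.
the dimension of the right vector space (a module over `ℍᵐᵒᵖ`) spanned by the columns. -/
noncomputable def qrank {n : ℕ} (A : Matrix (Fin n) (Fin n) ℍ[ℝ]) : ℕ :=
  Module.finrank (ℍ[ℝ])ᵐᵒᵖ (Submodule.span (ℍ[ℝ])ᵐᵒᵖ (Set.range (fun j : Fin n => A.col j)))

/-- The index: the least `k ≥ 0` with `rank A ^ (k + 1) = rank A ^ k`. -/
noncomputable def ind {n : ℕ} (A : Matrix (Fin n) (Fin n) ℍ[ℝ]) : ℕ :=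
  sInf {k : ℕ | qrank (A ^ (k + 1)) = qrank (A ^ k)}

/-- `X` is a Drazin inverse of `A`. -/
structure IsDrazinInverse {n : ℕ} (A X : Matrix (Fin n) (Fin n) ℍ[ℝ]) : Prop where
  pow_succ_mul : A ^ (ind A + 1) * X = A ^ ind A
  mul_mul : X * A * X = X
  comm : A * X = X * A

/-- `X` is a group inverse of `A`: `A` has index one and `X` is a Drazin inverse of `A`. -/
def IsGroupInverse {n : ℕ} (A X : Matrix (Fin n) (Fin n) ℍ[ℝ]) : Prop :=
  ind A = 1 ∧ IsDrazinInverse A X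

end QuatDet

/-!
The column determinant of a Hermitian quaternion matrix is a signed sum over permutations of
products of cycle products. Reversing a cycle conjugates its product, so after averaging over the
directions of all cycles every cycle product may be replaced by its real part. This makes the
determinant a real number independent of the chosen index (`cdet_eq_realDet`), and it turns the
column determinant at `i` with column `i` replaced by `b` into `∑ k, cofactor M i k * b k`, where
`cofactor M i k` is a signed sum over self-avoiding walks from `i` to `k` (`cdet_updateCol`,
`sum_cofactor_mul`).

The cofactors behave like an adjugate: `∑ k, cofactor M i k * M k j` is the determinant for
`i = j` (`sum_cofactor_mul_self`) and `0` otherwise (`sum_cofactor_mul_of_ne`). In the latter case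
a permutation `g` that separates `i` and `j` is paired with `g * swap i j`, in which their two
cycles are merged; the terms cancel once the cycle of `j` is averaged over its directions. The
same pairing expresses the cofactor at `(i, j)` of a principal submatrix containing `j` through
cofactors of the submatrix without `j` (`cofactor_eq_neg_sum`).

Let `B = A ^ 2`, let `d s` be the sum of the principal minors of `B` of order `s`, and let `C s`
be the matrix of the sums of cofactors of principal submatrices of order `s`. These facts give the
recursion `C s * B + C (s + 1) = d s • 1` (`cofactorSum_mul_add`), together with
`tr C (s + 1) = (n - s) * d s` (`trace_cofactorSum_succ`): they are the identities satisfied by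
the coefficients of the determinant and the adjugate of `t + B`, obtained without polynomials.

For a group inverse `G` of `A`, the matrix `A * G` is the projection onto the range of `A`. If `m`
is the largest order with `d m ≠ 0`, descending along the recursion gives
`C (m + 1) = d m • (1 - A * G)`. Taking real parts of traces, and using that the real part of the
trace of an idempotent is its rank (`re_trace_of_idempotent`), yields `m = r`. Then
`C r * B = d r • (A * G)`, hence `C r * A = d r • G` (`cofactorSum_mul_eq_smul`), which is the
column representation. The row representation is its conjugate transpose, because `A` and `G` are
Hermitian.
-/

namespace QuatDet

open Function (minimalPeriod)

/-! ### Walks along a permutation -/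

section Walk

variable {ι : Type*}

/-- The ordered product `M (g^m l) (g^(m-1) l) * ⋯ * M (g² l) (g l) * M (g l) l` along the first
`m` steps of `g` from `l`. The permutation `τ` of a column determinant enters as `g = τ⁻¹`. -/
def walk {R : Type*} [Ring R] (M : Matrix ι ι R) (g : ι → ι) : ℕ → ι → R
  | 0, _ => 1
  | m + 1, l => walk M g m (g l) * M (g l) l

theorem walk_succ' {R : Type*} [Ring R] (M : Matrix ι ι R) (g : ι → ι) (m : ℕ) (l : ι) :
    walk M g (m + 1) l = M (g^[m + 1] l) (g^[m] l) * walk M g m l := by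
  induction m generalizing l with
  | zero => simp [walk]
  | succ m ih =>
    rw [walk, ih, walk, mul_assoc]
    simp only [Function.iterate_succ_apply]

theorem walk_add {R : Type*} [Ring R] (M : Matrix ι ι R) (g : ι → ι) (a b : ℕ) (l : ι) :
    walk M g (a + b) l = walk M g a (g^[b] l) * walk M g b l := by
  induction b generalizing l with
  | zero => simp [walk]
  | succ b ih => rw [← add_assoc, walk, ih, walk, mul_assoc, Function.iterate_succ_apply]

theorem walk_congr {R : Type*} [Ring R] {M M' : Matrix ι ι R} {g g' : ι → ι} {m : ℕ} {l : ι}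
    (hg : ∀ t < m, g' (g^[t] l) = g (g^[t] l))
    (hM : ∀ t < m, M' (g^[t + 1] l) (g^[t] l) = M (g^[t + 1] l) (g^[t] l)) :
    walk M' g' m l = walk M g m l := by
  induction m generalizing l with
  | zero => rfl
  | succ m ih =>
    have h0 : g' l = g l := hg 0 (Nat.succ_pos m)
    have h1 : M' (g l) l = M (g l) l := hM 0 (Nat.succ_pos m)
    rw [walk, walk, h0, h1, ih]
    · intro t ht
      exact hg (t + 1) (by omega)
    · intro t ht
      exact hM (t + 1) (by omega)

theorem iterate_congr {g g' : ι → ι} {m : ℕ} {l : ι}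
    (hg : ∀ t < m, g' (g^[t] l) = g (g^[t] l)) : g'^[m] l = g^[m] l := by
  induction m with
  | zero => rfl
  | succ m ih =>
    rw [Function.iterate_succ_apply', Function.iterate_succ_apply', ih fun t ht => hg t (by omega),
      hg m (by omega)]

theorem walk_eq_zero {R : Type*} [Ring R] {M : Matrix ι ι R} {g : ι → ι} {m : ℕ} {l : ι} {t : ℕ}
    (ht : t < m) (h : M (g^[t + 1] l) (g^[t] l) = 0) : walk M g m l = 0 := by
  induction m generalizing l t with
  | zero => omega
  | succ m ih =>
    cases t with
    | zero => rw [walk, show M (g l) l = 0 from h, mul_zero]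
    | succ t => rw [walk, ih (l := g l) (t := t) (by omega) h, zero_mul]

/-- For a Hermitian matrix, walking backwards conjugates the product. -/
theorem star_walk {M : Matrix ι ι ℍ[ℝ]} (hM : M.IsHermitian) (g : Equiv.Perm ι) (m : ℕ) (l : ι) :
    star (walk M g m l) = walk M (g⁻¹ : Equiv.Perm ι) m (g^[m] l) := by
  induction m generalizing l with
  | zero => simp [walk]
  | succ m ih =>
    have h : ∀ k x, ((g⁻¹ : Equiv.Perm ι) : ι → ι)^[k] (g^[k] x) = x := fun k x =>
      (show Function.LeftInverse (g⁻¹ : Equiv.Perm ι) g from g.symm_apply_apply).iterate k x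
    rw [walk, star_mul, ih, walk_succ', h, hM.apply]
    rw [Function.iterate_succ_apply, h]

end Walk

/-! ### Cycles of a permutation of a finite type -/

section Cycle

variable {ι : Type*}

theorem sameCycle_iterate (g : Equiv.Perm ι) (l : ι) (t : ℕ) : g.SameCycle l (g^[t] l) := by
  rw [← Equiv.Perm.coe_pow]
  exact Equiv.Perm.sameCycle_pow_right.2 (Equiv.Perm.SameCycle.refl g l)

theorem apply_iterate_ne {g : Equiv.Perm ι} {l : ι} {t : ℕ} (ht : t < minimalPeriod g l - 1) :
    g^[t] (g l) ≠ l := by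
  rw [← Function.iterate_succ_apply]
  intro h
  exact Function.not_isPeriodicPt_of_pos_of_lt_minimalPeriod (Nat.succ_ne_zero t) (by omega) h

/-- The product around the whole cycle of `g` through `l`, with `l` as the last column index. -/
noncomputable def cycleProd {R : Type*} [Ring R] (M : Matrix ι ι R) (g : Equiv.Perm ι) (l : ι) :
    R :=
  walk M g (minimalPeriod g l) l

/-- The product around the cycle of `g` through `l` with its last factor `M (g l) l` left out. -/
noncomputable def pathProd {R : Type*} [Ring R] (M : Matrix ι ι R) (g : Equiv.Perm ι) (l : ι) : R :=
  walk M g (minimalPeriod g l - 1) (g l)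

theorem pathProd_of_apply_eq {R : Type*} [Ring R] (M : Matrix ι ι R) {g : Equiv.Perm ι} {l : ι}
    (h : g l = l) : pathProd M g l = 1 := by
  rw [pathProd, Function.minimalPeriod_eq_one_iff_isFixedPt.2 h]
  rfl

theorem sameCycle_apply_iterate (g : Equiv.Perm ι) (l : ι) (t : ℕ) :
    g.SameCycle l (g^[t] (g l)) := by
  rw [← Function.iterate_succ_apply]
  exact sameCycle_iterate g l _

theorem minimalPeriod_congr {g g' : Equiv.Perm ι} {l : ι} (h : ∀ x, g.SameCycle l x → g' x = g x) :
    minimalPeriod g' l = minimalPeriod g l := by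
  have key : ∀ t, g'^[t] l = g^[t] l := fun t =>
    iterate_congr fun s _ => h _ (sameCycle_iterate g l s)
  apply Nat.dvd_antisymm <;> apply Function.IsPeriodicPt.minimalPeriod_dvd
  · rw [Function.IsPeriodicPt, Function.IsFixedPt, key, Function.iterate_minimalPeriod]
  · rw [Function.IsPeriodicPt, Function.IsFixedPt, ← key, Function.iterate_minimalPeriod]

theorem pathProd_congr {R : Type*} [Ring R] {M M' : Matrix ι ι R} {g : Equiv.Perm ι} {l : ι}
    (hM : ∀ x, g.SameCycle l x → x ≠ l → M' (g x) x = M (g x) x) :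
    pathProd M' g l = pathProd M g l := by
  refine walk_congr (fun _ _ => rfl) fun t ht => ?_
  rw [Function.iterate_succ_apply']
  exact hM _ (sameCycle_apply_iterate g l t) (apply_iterate_ne ht)

theorem cycleProd_congr {R : Type*} [Ring R] {M M' : Matrix ι ι R} {g g' : Equiv.Perm ι} {l : ι}
    (hg : ∀ x, g.SameCycle l x → g' x = g x)
    (hM : ∀ x, g.SameCycle l x → M' (g x) x = M (g x) x) :
    cycleProd M' g' l = cycleProd M g l := by
  rw [cycleProd, cycleProd, minimalPeriod_congr hg]
  refine walk_congr (fun t _ => hg _ (sameCycle_iterate g l t)) fun t _ => ?_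
  rw [Function.iterate_succ_apply']
  exact hM _ (sameCycle_iterate g l t)

variable [Fintype ι]

theorem mem_periodicPts (g : Equiv.Perm ι) (l : ι) : l ∈ Function.periodicPts g :=
  Function.mk_mem_periodicPts (orderOf_pos g) (by
    rw [Function.IsPeriodicPt, Function.IsFixedPt, ← Equiv.Perm.coe_pow, pow_orderOf_eq_one]; rfl)

theorem minimalPeriod_pos (g : Equiv.Perm ι) (l : ι) : 0 < minimalPeriod g l :=
  Function.minimalPeriod_pos_of_mem_periodicPts (mem_periodicPts g l)

theorem sameCycle_iff_iterate {g : Equiv.Perm ι} {l x : ι} :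
    g.SameCycle l x ↔ ∃ t < minimalPeriod g l, g^[t] l = x := by
  constructor
  · intro h
    obtain ⟨t, rfl⟩ := h.exists_nat_pow_eq
    refine ⟨t % minimalPeriod g l, Nat.mod_lt _ (minimalPeriod_pos g l), ?_⟩
    rw [Function.iterate_mod_minimalPeriod_eq, Equiv.Perm.coe_pow]
  · rintro ⟨t, -, rfl⟩
    exact sameCycle_iterate g l t

theorem cycleLength_eq_minimalPeriod [DecidableEq ι] (g : Equiv.Perm ι) (l : ι) :
    cycleLength g l = minimalPeriod g l := by
  have h : (Finset.univ.filter fun m : ι => g.SameCycle l m) =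
      (Finset.range (minimalPeriod g l)).image fun t => g^[t] l := by
    ext x
    simp [sameCycle_iff_iterate]
  rw [cycleLength, h, Finset.card_image_of_injOn, Finset.card_range]
  intro a ha b hb hab
  exact Function.iterate_injOn_Iio_minimalPeriod (by simpa using ha) (by simpa using hb) hab

/-- A permutation that maps every point into its `g`-cycle has finer cycles than `g`. -/
theorem sameCycle_of_forall_apply {g g' : Equiv.Perm ι} (h : ∀ x, g.SameCycle x (g' x)) {x y : ι}
    (hxy : g'.SameCycle x y) : g.SameCycle x y := by
  obtain ⟨t, rfl⟩ := hxy.exists_nat_pow_eq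
  induction t with
  | zero => exact Equiv.Perm.SameCycle.refl g x
  | succ t ih =>
    rw [pow_succ', Equiv.Perm.mul_apply]
    exact (ih (sameCycle_iterate g' x t)).trans (h _)

theorem cycleProd_eq_pathProd_mul {R : Type*} [Ring R] (M : Matrix ι ι R) (g : Equiv.Perm ι)
    (l : ι) : cycleProd M g l = pathProd M g l * M (g l) l := by
  obtain ⟨m, hm⟩ := Nat.exists_eq_succ_of_ne_zero (minimalPeriod_pos g l).ne'
  rw [cycleProd, pathProd, hm]
  rfl

theorem iterate_pred_minimalPeriod (g : Equiv.Perm ι) (l : ι) :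
    g^[minimalPeriod g l - 1] (g l) = l := by
  rw [← Function.iterate_succ_apply, Nat.succ_eq_add_one,
    Nat.sub_add_cancel (minimalPeriod_pos g l), Function.iterate_minimalPeriod]

theorem colCycleProd_inv {R : Type*} [Ring R] [DecidableEq ι] (M : Matrix ι ι R)
    (g : Equiv.Perm ι) (l : ι) : colCycleProd M g⁻¹ l = cycleProd M g l := by
  have h : cycleLength g⁻¹ l = minimalPeriod g l := by
    rw [← cycleLength_eq_minimalPeriod]
    simp [cycleLength, Equiv.Perm.sameCycle_inv]
  rw [colCycleProd, cycleProd, h, inv_inv]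
  induction minimalPeriod g l with
  | zero => simp [walk]
  | succ m ih =>
    rw [List.range_succ, List.reverse_append, List.map_append, List.prod_append, ih, walk_succ']
    simp [Equiv.Perm.coe_pow]

theorem cycleProd_eq_zero {R : Type*} [Ring R] {M : Matrix ι ι R} {g : Equiv.Perm ι} {l x : ι}
    (hx : g.SameCycle l x) (h : M (g x) x = 0) : cycleProd M g l = 0 := by
  obtain ⟨t, ht, rfl⟩ := sameCycle_iff_iterate.1 hx
  exact walk_eq_zero ht (by rwa [Function.iterate_succ_apply'])

theorem pathProd_eq_zero {R : Type*} [Ring R] {M : Matrix ι ι R} {g : Equiv.Perm ι} {l x : ι}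
    (hx : g.SameCycle l x) (hxl : x ≠ l) (h : M (g x) x = 0) : pathProd M g l = 0 := by
  obtain ⟨t, ht, rfl⟩ := sameCycle_iff_iterate.1 hx
  cases t with
  | zero => exact absurd rfl hxl
  | succ t => exact walk_eq_zero (t := t) (by omega) (by rwa [Function.iterate_succ_apply'])

theorem cycleProd_of_apply_eq {R : Type*} [Ring R] (M : Matrix ι ι R) {g : Equiv.Perm ι} {l : ι}
    (h : g l = l) : cycleProd M g l = M l l := by
  rw [cycleProd_eq_pathProd_mul, pathProd_of_apply_eq M h, one_mul, h]

theorem re_mul_comm (a b : ℍ[ℝ]) : (a * b).re = (b * a).re := by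
  simp only [Quaternion.re_mul]
  ring

/-- The real part of a cycle product does not depend on the point at which the cycle is opened. -/
theorem re_cycleProd_eq (M : Matrix ι ι ℍ[ℝ]) {g : Equiv.Perm ι} {l x : ι}
    (h : g.SameCycle l x) : (cycleProd M g l).re = (cycleProd M g x).re := by
  obtain ⟨t, rfl⟩ := h.exists_nat_pow_eq
  induction t with
  | zero => rfl
  | succ t ih =>
    rw [ih (sameCycle_iterate g l t), pow_succ', Equiv.Perm.mul_apply]
    set y := (g ^ t) l
    obtain ⟨m, hm⟩ := Nat.exists_eq_succ_of_ne_zero (minimalPeriod_pos g y).ne'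
    have hp : minimalPeriod g (g y) = m + 1 := by
      rw [Function.minimalPeriod_apply (mem_periodicPts g y), hm]
    have h1 : g^[m] (g y) = y := by
      rw [← Function.iterate_succ_apply, ← hm, Function.iterate_minimalPeriod]
    rw [cycleProd, cycleProd, hm, hp, walk, walk_succ', re_mul_comm,
      Function.iterate_succ_apply', h1]

end Cycle

/-! ### Reversing one cycle -/

section Rev

variable {ι : Type*} [Fintype ι] [DecidableEq ι]

/-- The permutation `g` with the direction of its cycle through `a` reversed. -/
def rev (a : ι) (g : Equiv.Perm ι) : Equiv.Perm ι where
  toFun x := if g.SameCycle a x then g⁻¹ x else g x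
  invFun x := if g.SameCycle a x then g x else g⁻¹ x
  left_inv x := by
    by_cases h : g.SameCycle a x
    · have h' : g.SameCycle a (g⁻¹ x) := by simpa using h
      simp only [h, if_true, h']; exact g.apply_symm_apply x
    · have h' : ¬ g.SameCycle a (g x) := by simpa using h
      simp only [h, if_false, h']; exact g.symm_apply_apply x
  right_inv x := by
    by_cases h : g.SameCycle a x
    · have h' : g.SameCycle a (g x) := by simpa using h
      simp only [h, if_true, h']; exact g.symm_apply_apply x
    · have h' : ¬ g.SameCycle a (g⁻¹ x) := by simpa using h
      simp only [h, if_false, h']; exact g.apply_symm_apply x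

theorem rev_apply (a : ι) (g : Equiv.Perm ι) (x : ι) :
    rev a g x = if g.SameCycle a x then g⁻¹ x else g x := rfl

theorem rev_apply_of_not {a : ι} {g : Equiv.Perm ι} {x : ι} (h : ¬ g.SameCycle a x) :
    rev a g x = g x := by rw [rev_apply, if_neg h]

theorem sameCycle_rev {a : ι} {g : Equiv.Perm ι} {x y : ι} :
    (rev a g).SameCycle x y ↔ g.SameCycle x y := by
  constructor
  · refine sameCycle_of_forall_apply fun x => ?_
    rw [rev_apply]
    split_ifs <;> simp [Equiv.Perm.SameCycle.refl]
  · refine sameCycle_of_forall_apply fun x => ?_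
    by_cases h : g.SameCycle a x
    · have h1 : rev a g (g x) = x := by
        rw [rev_apply, if_pos (by simpa using h)]; exact g.symm_apply_apply x
      exact Equiv.Perm.SameCycle.symm (by simpa [h1] using sameCycle_iterate (rev a g) (g x) 1)
    · simpa [rev_apply_of_not h] using sameCycle_iterate (rev a g) x 1

theorem rev_rev (a : ι) (g : Equiv.Perm ι) : rev a (rev a g) = g := by
  ext x
  rw [rev_apply]
  simp only [sameCycle_rev]
  by_cases h : g.SameCycle a x
  · rw [if_pos h, Equiv.Perm.inv_eq_iff_eq, rev_apply, if_pos (by simpa using h)]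
    exact (g.symm_apply_apply x).symm
  · rw [if_neg h, rev_apply_of_not h]

theorem cycleProd_rev_of_not {R : Type*} [Ring R] (M : Matrix ι ι R) {a l : ι} {g : Equiv.Perm ι}
    (h : ¬ g.SameCycle a l) : cycleProd M (rev a g) l = cycleProd M g l :=
  cycleProd_congr (fun _ hx => rev_apply_of_not fun h' => h (h'.trans hx.symm)) fun _ _ => rfl

theorem pathProd_rev_of_not {R : Type*} [Ring R] (M : Matrix ι ι R) {a l : ι} {g : Equiv.Perm ι}
    (h : ¬ g.SameCycle a l) : pathProd M (rev a g) l = pathProd M g l := by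
  have hg : ∀ x, g.SameCycle l x → rev a g x = g x :=
    fun _ hx => rev_apply_of_not fun h' => h (h'.trans hx.symm)
  rw [pathProd, pathProd, minimalPeriod_congr hg, hg l (Equiv.Perm.SameCycle.refl g l)]
  exact walk_congr (fun t _ => hg _ (sameCycle_apply_iterate g l t)) fun _ _ => rfl

theorem cycleProd_rev {M : Matrix ι ι ℍ[ℝ]} (hM : M.IsHermitian) (g : Equiv.Perm ι) (a : ι) :
    cycleProd M (rev a g) a = star (cycleProd M g a) := by
  have h1 : cycleProd M (rev a g) a = cycleProd M g⁻¹ a := by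
    refine cycleProd_congr (fun x hx => ?_) fun _ _ => rfl
    rw [rev_apply, if_pos (by simpa [Equiv.Perm.sameCycle_inv] using hx)]
  have h2 : minimalPeriod (g⁻¹ : Equiv.Perm ι) a = minimalPeriod g a := by
    rw [← cycleLength_eq_minimalPeriod, ← cycleLength_eq_minimalPeriod]
    simp [cycleLength, Equiv.Perm.sameCycle_inv]
  rw [h1, cycleProd, cycleProd, star_walk hM, h2, Function.iterate_minimalPeriod]

end Rev

/-! ### Least elements of cycles -/

section Mins

variable {ι : Type*} [Fintype ι] [LinearOrder ι]

/-- The least elements of the cycles of `g`, fixed points included. -/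
def cycleMins (g : Equiv.Perm ι) : Finset ι :=
  Finset.univ.filter fun l : ι => ∀ m : ι, g.SameCycle l m → l ≤ m

/-- The least elements of the cycles of `g` that do not contain `i`. -/
def otherMins (g : Equiv.Perm ι) (i : ι) : Finset ι :=
  Finset.univ.filter fun l : ι => ¬ g.SameCycle i l ∧ ∀ m : ι, g.SameCycle l m → l ≤ m

theorem mem_cycleMins {g : Equiv.Perm ι} {l : ι} :
    l ∈ cycleMins g ↔ ∀ m : ι, g.SameCycle l m → l ≤ m := by
  simp [cycleMins]

theorem mem_otherMins {g : Equiv.Perm ι} {i l : ι} :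
    l ∈ otherMins g i ↔ ¬ g.SameCycle i l ∧ ∀ m : ι, g.SameCycle l m → l ≤ m := by
  simp [otherMins]

theorem exists_mem_cycleMins (g : Equiv.Perm ι) (i : ι) : ∃ m ∈ cycleMins g, g.SameCycle i m := by
  have hne : (Finset.univ.filter fun m : ι => g.SameCycle i m).Nonempty :=
    ⟨i, by simp [Equiv.Perm.SameCycle.refl]⟩
  have hm := Finset.min'_mem _ hne
  rw [Finset.mem_filter] at hm
  refine ⟨_, mem_cycleMins.2 fun x hx => Finset.min'_le _ _ ?_, hm.2⟩
  simpa using hm.2.trans hx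

theorem eq_of_mem_cycleMins {g : Equiv.Perm ι} {l m : ι} (hl : l ∈ cycleMins g)
    (hm : m ∈ cycleMins g) (h : g.SameCycle l m) : l = m :=
  le_antisymm (mem_cycleMins.1 hl _ h) (mem_cycleMins.1 hm _ h.symm)

theorem cycleMins_eq_insert {g : Equiv.Perm ι} {i m : ι} (hm : m ∈ cycleMins g)
    (him : g.SameCycle i m) : cycleMins g = insert m (otherMins g i) := by
  ext l
  rw [Finset.mem_insert, mem_otherMins, ← mem_cycleMins]
  constructor
  · intro hl
    by_cases h : g.SameCycle i l
    · exact Or.inl (eq_of_mem_cycleMins hl hm (h.symm.trans him))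
    · exact Or.inr ⟨h, hl⟩
  · rintro (rfl | h)
    · exact hm
    · exact h.2

theorem card_cycleMins (g : Equiv.Perm ι) (i : ι) :
    (cycleMins g).card = (otherMins g i).card + 1 := by
  obtain ⟨m, hm, him⟩ := exists_mem_cycleMins g i
  rw [cycleMins_eq_insert hm him, Finset.card_insert_of_notMem]
  exact fun h => (mem_otherMins.1 h).1 him

theorem prod_cycleMins {g : Equiv.Perm ι} (f : ι → ℝ) (hf : ∀ l m, g.SameCycle l m → f l = f m)
    (i : ι) : ∏ l ∈ cycleMins g, f l = (∏ l ∈ otherMins g i, f l) * f i := by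
  obtain ⟨m, hm, him⟩ := exists_mem_cycleMins g i
  rw [cycleMins_eq_insert hm him, Finset.prod_insert, hf i m him, mul_comm]
  exact fun h => (mem_otherMins.1 h).1 him

/-- The sign `(-1) ^ (n - s)` of a permutation with `s` cycles, written as `(-1) ^ (n + s)` to
avoid truncated subtraction. -/
noncomputable def cycleSign (g : Equiv.Perm ι) : ℝ :=
  (-1) ^ (Fintype.card ι + (cycleMins g).card)

theorem otherLeaders_eq (g : Equiv.Perm ι) (i : ι) :
    otherLeaders g i = (otherMins g i).sort (· ≤ ·) := rfl

/-- The truncated subtraction in the exponent is a true one: there are at most `n` cycles. -/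
theorem neg_one_pow_leaders (g : Equiv.Perm ι) (i : ι) :
    (-1 : ℍ[ℝ]) ^ (Fintype.card ι - (leaders g i).length) = (cycleSign g : ℍ[ℝ]) := by
  have h1 : (leaders g i).length = (cycleMins g).card := by
    rw [leaders, List.length_cons, otherLeaders_eq, Finset.length_sort, card_cycleMins g i]
  have h2 : (cycleMins g).card ≤ Fintype.card ι := Finset.card_le_univ _
  obtain ⟨k, hk⟩ := Nat.exists_eq_add_of_le h2
  rw [h1, cycleSign, hk, Nat.add_sub_cancel_left]
  push_cast
  rw [show (cycleMins g).card + k + (cycleMins g).card = 2 * (cycleMins g).card + k by ring,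
    pow_add, pow_mul]
  simp

theorem cycleMins_congr {g g' : Equiv.Perm ι} (h : ∀ x y, g'.SameCycle x y ↔ g.SameCycle x y) :
    cycleMins g' = cycleMins g := by
  simp [cycleMins, h]

theorem otherMins_congr {g g' : Equiv.Perm ι} (h : ∀ x y, g'.SameCycle x y ↔ g.SameCycle x y)
    (i : ι) : otherMins g' i = otherMins g i := by
  simp [otherMins, h]

theorem cycleSign_congr {g g' : Equiv.Perm ι} (h : ∀ x y, g'.SameCycle x y ↔ g.SameCycle x y) :
    cycleSign g' = cycleSign g := by
  rw [cycleSign, cycleSign, cycleMins_congr h]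

end Mins

/-! ### Column determinants with one free column -/

/-- Two sums agree if the summands of one become those of the other after averaging over `φ`. -/
theorem sum_eq_of_add_comp_eq {α V : Type*} [Fintype α] [AddCommGroup V] [Module ℝ V]
    {F F' : α → V} {φ : α → α} (hφ : Function.Bijective φ) (h : ∀ x, F x + F (φ x) = F' x + F' x) :
    ∑ x, F x = ∑ x, F' x := by
  have h1 : ∑ x, F x + ∑ x, F x = ∑ x, F' x + ∑ x, F' x := by
    have h2 := Finset.sum_congr (rfl : (Finset.univ : Finset α) = _) fun x _ => h x
    rwa [Finset.sum_add_distrib, Finset.sum_add_distrib, hφ.sum_comp F] at h2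
  rw [← two_smul ℝ, ← two_smul ℝ (∑ x, F' x)] at h1
  exact smul_right_injective V (two_ne_zero' ℝ) h1

/-- A noncommutative product is additive in the factor at a single index `a`. -/
theorem list_prod_map_add {α : Type*} {L : List α} (hL : L.Nodup) {a : α} (ha : a ∈ L)
    {f₁ f₂ f₃ : α → ℍ[ℝ]} (h₂ : ∀ l ∈ L, l ≠ a → f₂ l = f₁ l) (h₃ : ∀ l ∈ L, l ≠ a → f₃ l = f₁ l)
    (h : f₁ a + f₂ a = f₃ a + f₃ a) :
    (L.map f₁).prod + (L.map f₂).prod = (L.map f₃).prod + (L.map f₃).prod := by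
  obtain ⟨s, t, rfl⟩ := List.append_of_mem ha
  have hs : ∀ l ∈ s, l ≠ a := by
    rintro l hl rfl
    exact (List.nodup_append.1 hL).2.2 l hl l (by simp) rfl
  have ht : ∀ l ∈ t, l ≠ a := by
    rintro l hl rfl
    exact (List.nodup_cons.1 (List.nodup_append.1 hL).2.1).1 hl
  have e₂ : s.map f₂ = s.map f₁ := List.map_congr_left fun l hl => h₂ l (by simp [hl]) (hs l hl)
  have e₃ : s.map f₃ = s.map f₁ := List.map_congr_left fun l hl => h₃ l (by simp [hl]) (hs l hl)
  have d₂ : t.map f₂ = t.map f₁ := List.map_congr_left fun l hl => h₂ l (by simp [hl]) (ht l hl)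
  have d₃ : t.map f₃ = t.map f₁ := List.map_congr_left fun l hl => h₃ l (by simp [hl]) (ht l hl)
  simp only [List.map_append, List.map_cons, List.prod_append, List.prod_cons, e₂, e₃, d₂, d₃]
  rw [← mul_add, ← mul_add, ← add_mul, ← add_mul, h]

theorem add_star_eq (q : ℍ[ℝ]) : q + star q = ((q.re : ℝ) : ℍ[ℝ]) + ((q.re : ℝ) : ℍ[ℝ]) := by
  rw [Quaternion.self_add_star, two_mul]

theorem coe_sum {α : Type*} (s : Finset α) (f : α → ℝ) :
    ((∑ x ∈ s, f x : ℝ) : ℍ[ℝ]) = ∑ x ∈ s, (f x : ℍ[ℝ]) :=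
  map_sum (algebraMap ℝ ℍ[ℝ]) f s

theorem coe_list_prod {α : Type*} (L : List α) (f : α → ℝ) :
    (((L.map f).prod : ℝ) : ℍ[ℝ]) = (L.map fun x => (f x : ℍ[ℝ])).prod := by
  induction L with
  | nil => simp
  | cons a L ih => simp [ih]

section Cofactor

variable {ι : Type*} [Fintype ι] [LinearOrder ι]

/-- The signed product of the real parts of the cycle products of `g` over the cycles that do not
contain `i`. -/
noncomputable def weight (M : Matrix ι ι ℍ[ℝ]) (g : Equiv.Perm ι) (i : ι) : ℝ :=
  cycleSign g * ∏ l ∈ otherMins g i, (cycleProd M g l).re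

/-- The summand of a column determinant at `i` whose column `i` is `b`, with the cycle products of
the leaders in `S` replaced by their real parts. -/
noncomputable def partialTerm (M : Matrix ι ι ℍ[ℝ]) (i : ι) (b : ι → ℍ[ℝ]) (S : Finset ι)
    (g : Equiv.Perm ι) : ℍ[ℝ] :=
  (cycleSign g : ℍ[ℝ]) * ((((otherMins g i).sort (· ≤ ·)).reverse.map fun l =>
    if l ∈ S then ((cycleProd M g l).re : ℍ[ℝ]) else cycleProd M g l).prod *
      (pathProd M g i * b (g i)))

theorem partialTerm_empty (M : Matrix ι ι ℍ[ℝ]) (i : ι) (b : ι → ℍ[ℝ]) :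
    cdet i (M.updateCol i b) = ∑ g, partialTerm M i b ∅ g := by
  rw [cdet, ← Equiv.sum_comp (Equiv.inv _)]
  refine Finset.sum_congr rfl fun g _ => ?_
  have hinv : ∀ x y, (g⁻¹).SameCycle x y ↔ g.SameCycle x y :=
    fun _ _ => Equiv.Perm.sameCycle_inv
  have hi : cycleProd (M.updateCol i b) g i = pathProd M g i * b (g i) := by
    rw [cycleProd_eq_pathProd_mul, Matrix.updateCol_self,
      pathProd_congr fun x _ hx => Matrix.updateCol_ne hx]
  have hl : ∀ l ∈ ((otherMins g i).sort (· ≤ ·)).reverse,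
      colCycleProd (M.updateCol i b) g⁻¹ l = cycleProd M g l := by
    intro l hl
    rw [colCycleProd_inv]
    rw [List.mem_reverse, Finset.mem_sort, mem_otherMins] at hl
    exact cycleProd_congr (fun _ _ => rfl) fun x hx =>
      Matrix.updateCol_ne fun h => hl.1 (h ▸ hx.symm)
  rw [Equiv.inv_apply, neg_one_pow_leaders, cycleSign_congr hinv, partialTerm, leaders,
    otherLeaders_eq, otherMins_congr hinv, List.reverse_cons, List.map_append, List.prod_append,
    List.map_congr_left hl]
  simp only [colCycleProd_inv, List.map_cons, List.map_nil, List.prod_cons, List.prod_nil, mul_one,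
    hi, Finset.notMem_empty, if_false]

/-- Averaging over the two directions of the cycle led by `a` makes its cycle product real. -/
theorem sum_partialTerm_insert {M : Matrix ι ι ℍ[ℝ]} (hM : M.IsHermitian) (i : ι) (b : ι → ℍ[ℝ])
    (S : Finset ι) {a : ι} (ha : a ∉ S) :
    ∑ g, partialTerm M i b S g = ∑ g, partialTerm M i b (insert a S) g := by
  let φ : Equiv.Perm ι → Equiv.Perm ι := fun g => if a ∈ otherMins g i then rev a g else g
  have hφ : Function.Involutive φ := by
    intro g
    by_cases h : a ∈ otherMins g i
    · have h' : a ∈ otherMins (rev a g) i := by rwa [otherMins_congr fun _ _ => sameCycle_rev]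
      simp only [φ, if_pos h, if_pos h', rev_rev]
    · simp only [φ, if_neg h]
  refine sum_eq_of_add_comp_eq hφ.bijective fun g => ?_
  by_cases h : a ∈ otherMins g i
  · have hia : ¬ g.SameCycle a i := fun h' => (mem_otherMins.1 h).1 h'.symm
    have hL : ((otherMins g i).sort (· ≤ ·)).reverse.Nodup :=
      List.nodup_reverse.2 (Finset.sort_nodup _ _)
    have hne : ∀ l ∈ ((otherMins g i).sort (· ≤ ·)).reverse, l ≠ a → ¬ g.SameCycle a l := by
      intro l hl hla hal
      rw [List.mem_reverse, Finset.mem_sort, mem_otherMins] at hl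
      exact hla (eq_of_mem_cycleMins (mem_cycleMins.2 hl.2)
        (mem_cycleMins.2 (mem_otherMins.1 h).2) hal.symm)
    simp only [φ, if_pos h, partialTerm]
    rw [otherMins_congr (fun _ _ => sameCycle_rev), cycleSign_congr fun _ _ => sameCycle_rev,
      pathProd_rev_of_not M hia, rev_apply_of_not hia, ← mul_add, ← add_mul, ← mul_add, ← add_mul]
    congr 2
    refine list_prod_map_add hL (by simpa using h) (fun l hl hla => ?_) (fun l hl hla => ?_) ?_
    · rw [cycleProd_rev_of_not M (hne l hl hla)]
    · simp [hla]
    · simp only [ha, if_false, Finset.mem_insert_self, if_true, cycleProd_rev hM, add_star_eq]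
  · have e : partialTerm M i b (insert a S) g = partialTerm M i b S g := by
      rw [partialTerm, partialTerm]
      congr 3
      refine List.map_congr_left fun l hl => ?_
      have hla : l ≠ a := by
        rintro rfl
        exact h (by simpa using hl)
      simp [hla]
    simp only [φ, if_neg h, e]

/-- For a Hermitian matrix with column `i` replaced by `b`, the cycle products away from `i` in
the column determinant at `i` may be replaced by their real parts. -/
theorem cdet_updateCol {M : Matrix ι ι ℍ[ℝ]} (hM : M.IsHermitian) (i : ι) (b : ι → ℍ[ℝ]) :
    cdet i (M.updateCol i b) = ∑ g : Equiv.Perm ι, weight M g i • (pathProd M g i * b (g i)) := by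
  have h : ∀ S : Finset ι, cdet i (M.updateCol i b) = ∑ g, partialTerm M i b S g := by
    intro S
    induction S using Finset.induction_on with
    | empty => exact partialTerm_empty M i b
    | insert a S ha ih => rw [ih, sum_partialTerm_insert hM i b S ha]
  rw [h Finset.univ]
  refine Finset.sum_congr rfl fun g _ => ?_
  have e : (((otherMins g i).sort (· ≤ ·)).reverse.map fun l =>
      ((cycleProd M g l).re : ℍ[ℝ])).prod =
      ((∏ l ∈ otherMins g i, (cycleProd M g l).re : ℝ) : ℍ[ℝ]) := by
    have hL : ((otherMins g i).sort (· ≤ ·)).reverse.Nodup :=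
      List.nodup_reverse.2 (Finset.sort_nodup _ _)
    have hp := List.prod_toFinset (fun l => (cycleProd M g l).re) hL
    rw [List.toFinset_reverse, Finset.sort_toFinset] at hp
    rw [hp, coe_list_prod]
  simp only [partialTerm, Finset.mem_univ, if_true]
  rw [e, weight, ← mul_assoc, ← Quaternion.coe_mul, Quaternion.coe_mul_eq_smul]

/-- For Hermitian `M`, the coefficient of `b k` in the column determinant at `i` of `M` with
column `i` replaced by `b`: a signed sum over the self-avoiding walks from `i` to `k`. -/
noncomputable def cofactor (M : Matrix ι ι ℍ[ℝ]) (i k : ι) : ℍ[ℝ] :=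
  ∑ g : Equiv.Perm ι, if g i = k then weight M g i • pathProd M g i else 0

theorem sum_cofactor_mul (M : Matrix ι ι ℍ[ℝ]) (i : ι) (b : ι → ℍ[ℝ]) :
    ∑ k, cofactor M i k * b k =
      ∑ g : Equiv.Perm ι, weight M g i • (pathProd M g i * b (g i)) := by
  simp only [cofactor, Finset.sum_mul]
  rw [Finset.sum_comm]
  refine Finset.sum_congr rfl fun g _ => ?_
  simp [ite_mul]

/-- The determinant of a Hermitian matrix as a real number: the signed sum over permutations of
the products of the real parts of the cycle products. -/
noncomputable def realDet (M : Matrix ι ι ℍ[ℝ]) : ℝ :=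
  ∑ g : Equiv.Perm ι, cycleSign g * ∏ l ∈ cycleMins g, (cycleProd M g l).re

theorem weight_mul_re (M : Matrix ι ι ℍ[ℝ]) (g : Equiv.Perm ι) (i : ι) :
    weight M g i * (cycleProd M g i).re =
      cycleSign g * ∏ l ∈ cycleMins g, (cycleProd M g l).re := by
  rw [prod_cycleMins (fun l => (cycleProd M g l).re) (fun _ _ h => re_cycleProd_eq M h) i, weight,
    mul_assoc]

theorem weight_rev (M : Matrix ι ι ℍ[ℝ]) (g : Equiv.Perm ι) (i : ι) :
    weight M (rev i g) i = weight M g i := by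
  rw [weight, weight, cycleSign_congr fun _ _ => sameCycle_rev,
    otherMins_congr fun _ _ => sameCycle_rev]
  congr 1
  refine Finset.prod_congr rfl fun l hl => ?_
  rw [cycleProd_rev_of_not M (mem_otherMins.1 hl).1]

/-- The diagonal case of the adjugate identity, by averaging over the directions of the cycle of
`i`. -/
theorem sum_cofactor_mul_self {M : Matrix ι ι ℍ[ℝ]} (hM : M.IsHermitian) (i : ι) :
    ∑ k, cofactor M i k * M k i = (realDet M : ℍ[ℝ]) := by
  have h : (realDet M : ℍ[ℝ]) =
      ∑ g : Equiv.Perm ι, weight M g i • (((cycleProd M g i).re : ℝ) : ℍ[ℝ]) := by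
    rw [realDet, coe_sum]
    refine Finset.sum_congr rfl fun g _ => ?_
    rw [← weight_mul_re M g i, Quaternion.coe_mul, Quaternion.coe_mul_eq_smul]
  rw [sum_cofactor_mul, h]
  refine sum_eq_of_add_comp_eq (φ := rev i) (Function.Involutive.bijective (rev_rev i)) fun g => ?_
  rw [← cycleProd_eq_pathProd_mul, ← cycleProd_eq_pathProd_mul, weight_rev, cycleProd_rev hM,
    ← smul_add, ← smul_add, add_star_eq]

theorem cdet_eq_realDet {M : Matrix ι ι ℍ[ℝ]} (hM : M.IsHermitian) (i : ι) :
    cdet i M = (realDet M : ℍ[ℝ]) := by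
  rw [← sum_cofactor_mul_self hM i, sum_cofactor_mul, ← cdet_updateCol hM i fun k => M k i]
  congr 1
  exact (Matrix.updateCol_eq_self M i).symm

theorem rdet_eq_star_cdet (M : Matrix ι ι ℍ[ℝ]) (i : ι) : rdet i M = star (cdet i Mᴴ) := by
  rw [rdet, cdet, star_sum, ← Equiv.sum_comp (Equiv.inv _)]
  refine Finset.sum_congr rfl fun g _ => ?_
  have hinv : ∀ x y, (g⁻¹).SameCycle x y ↔ g.SameCycle x y :=
    fun _ _ => Equiv.Perm.sameCycle_inv
  have hl : leaders g⁻¹ i = leaders g i := by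
    rw [leaders, leaders, otherLeaders_eq, otherLeaders_eq, otherMins_congr hinv]
  have hc : ∀ l, star (colCycleProd Mᴴ g l) = rowCycleProd M g⁻¹ l := by
    intro l
    have hlen : cycleLength g⁻¹ l = cycleLength g l := by simp [cycleLength, hinv]
    rw [colCycleProd, rowCycleProd, hlen]
    induction cycleLength g l with
    | zero => simp
    | succ m ih =>
      rw [List.range_succ, List.reverse_append, List.map_append, List.map_append, List.prod_append,
        List.prod_append, star_mul, ih]
      simp
  rw [Equiv.inv_apply, hl, neg_one_pow_leaders, star_mul, Quaternion.star_coe,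
    Quaternion.coe_commutes]
  congr 1
  induction leaders g i with
  | nil => simp
  | cons a L ih =>
    rw [List.reverse_cons, List.map_append, List.prod_append, star_mul, ← ih]
    simp [hc]

theorem hdet_eq_realDet {M : Matrix ι ι ℍ[ℝ]} (hM : M.IsHermitian) :
    hdet M = (realDet M : ℍ[ℝ]) := by
  rw [hdet]
  split_ifs with h
  · rw [rdet_eq_star_cdet, hM.eq, cdet_eq_realDet hM, Quaternion.star_coe]
  · have : IsEmpty ι := Finset.univ_eq_empty_iff.1 (Finset.not_nonempty_iff_eq_empty.1 h)
    simp [realDet, cycleSign, Finset.eq_empty_of_isEmpty]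

end Cofactor

/-! ### Merging two cycles by a transposition -/

section Swap

variable {ι : Type*}

theorem mul_swap_apply_left [DecidableEq ι] (g : Equiv.Perm ι) (i j : ι) :
    (g * Equiv.swap i j) i = g j := by
  simp

theorem mul_swap_apply_right [DecidableEq ι] (g : Equiv.Perm ι) (i j : ι) :
    (g * Equiv.swap i j) j = g i := by
  simp

theorem mul_swap_apply_of_ne [DecidableEq ι] {g : Equiv.Perm ι} {i j x : ι} (hi : x ≠ i)
    (hj : x ≠ j) :
    (g * Equiv.swap i j) x = g x := by
  simp [Equiv.swap_apply_of_ne_of_ne hi hj]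

/-- Before it closes up, the walk along the `g`-cycle of `j` is also a walk along `g * swap i j`
if `i` lies in another cycle. -/
theorem mul_swap_apply_iterate [DecidableEq ι] {g : Equiv.Perm ι} {i j : ι}
    (h : ¬ g.SameCycle i j) {t : ℕ} (ht : t < minimalPeriod g j - 1) :
    (g * Equiv.swap i j) (g^[t] (g j)) = g (g^[t] (g j)) := by
  refine mul_swap_apply_of_ne (fun hi => h ?_) (apply_iterate_ne ht)
  exact (hi ▸ sameCycle_apply_iterate g j t : g.SameCycle j i).symm

theorem mul_swap_apply_of_not_sameCycle [DecidableEq ι] {g : Equiv.Perm ι} {i j x : ι}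
    (hi : ¬ g.SameCycle i x) (hj : ¬ g.SameCycle j x) : (g * Equiv.swap i j) x = g x :=
  mul_swap_apply_of_ne (fun e => hi (e ▸ Equiv.Perm.SameCycle.refl g x))
    (fun e => hj (e ▸ Equiv.Perm.SameCycle.refl g x))

theorem iterate_mul_swap [DecidableEq ι] {g : Equiv.Perm ι} {i j : ι}
    (h : ¬ g.SameCycle i j) {t : ℕ} (ht : t ≤ minimalPeriod g j - 1) :
    (g * Equiv.swap i j)^[t + 1] i = g^[t + 1] j := by
  rw [Function.iterate_succ_apply, Function.iterate_succ_apply, mul_swap_apply_left]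
  exact iterate_congr fun s hs => mul_swap_apply_iterate h (by omega)

variable [Fintype ι] [LinearOrder ι]

theorem sameCycle_mul_swap_of_right {g : Equiv.Perm ι} {i j x : ι} (h : ¬ g.SameCycle i j)
    (hx : g.SameCycle j x) : (g * Equiv.swap i j).SameCycle i x := by
  obtain ⟨t, ht, rfl⟩ := sameCycle_iff_iterate.1 hx
  cases t with
  | zero =>
    have e := iterate_mul_swap h (le_refl (minimalPeriod g j - 1))
    rw [Function.iterate_succ_apply g, iterate_pred_minimalPeriod] at e
    rw [Function.iterate_zero_apply]
    have hs := sameCycle_iterate (g * Equiv.swap i j) i (minimalPeriod g j - 1 + 1)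
    rwa [e] at hs
  | succ t =>
    rw [← iterate_mul_swap h (by omega)]
    exact sameCycle_iterate _ _ _

theorem sameCycle_mul_swap {g : Equiv.Perm ι} {i j : ι} (h : ¬ g.SameCycle i j) :
    (g * Equiv.swap i j).SameCycle i j :=
  sameCycle_mul_swap_of_right h (Equiv.Perm.SameCycle.refl g j)

theorem sameCycle_mul_swap_iff {g : Equiv.Perm ι} {i j x : ι} (h : ¬ g.SameCycle i j) :
    (g * Equiv.swap i j).SameCycle i x ↔ g.SameCycle i x ∨ g.SameCycle j x := by
  constructor
  · intro hx
    obtain ⟨t, -, rfl⟩ := sameCycle_iff_iterate.1 hx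
    clear hx
    induction t with
    | zero => exact Or.inl (Equiv.Perm.SameCycle.refl g i)
    | succ t ih =>
      rw [Function.iterate_succ_apply']
      set y := (g * Equiv.swap i j)^[t] i
      by_cases hi : y = i
      · rw [hi, mul_swap_apply_left]
        exact Or.inr (sameCycle_iterate g j 1)
      by_cases hj : y = j
      · rw [hj, mul_swap_apply_right]
        exact Or.inl (sameCycle_iterate g i 1)
      rw [mul_swap_apply_of_ne hi hj]
      simpa using ih
  · rintro (hx | hx)
    · have h' : ¬ g.SameCycle j i := fun h' => h h'.symm
      have := sameCycle_mul_swap_of_right h' hx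
      rw [Equiv.swap_comm] at this
      exact (sameCycle_mul_swap h).trans this
    · exact sameCycle_mul_swap_of_right h hx

theorem sameCycle_mul_swap_iff_of_not {g : Equiv.Perm ι} {i j x y : ι} (hi : ¬ g.SameCycle i x)
    (hj : ¬ g.SameCycle j x) : (g * Equiv.swap i j).SameCycle x y ↔ g.SameCycle x y := by
  have key : ∀ t, (g * Equiv.swap i j)^[t] x = g^[t] x := fun t =>
    iterate_congr fun s _ => mul_swap_apply_of_not_sameCycle
      (fun h => hi (h.trans (sameCycle_iterate g x s).symm))
      (fun h => hj (h.trans (sameCycle_iterate g x s).symm))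
  constructor
  · intro h
    obtain ⟨t, -, rfl⟩ := sameCycle_iff_iterate.1 h
    rw [key]
    exact sameCycle_iterate g x t
  · intro h
    obtain ⟨t, -, rfl⟩ := sameCycle_iff_iterate.1 h
    rw [← key]
    exact sameCycle_iterate _ x t

/-- If `i` and `j` lie on one cycle of `g`, then `g * swap i j` separates them. -/
theorem not_sameCycle_mul_swap {g : Equiv.Perm ι} {i j : ι} (hij : i ≠ j) (h : g.SameCycle i j) :
    ¬ (g * Equiv.swap i j).SameCycle i j := by
  have hex : ∃ u, g^[u] j = i := by
    obtain ⟨u, -, hu⟩ := sameCycle_iff_iterate.1 h.symm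
    exact ⟨u, hu⟩
  classical
  -- `u` is the number of steps from `j` to its first visit of `i`; the new cycle of `i` is
  -- `g j, …, g^u j = i`.
  obtain ⟨u, hu, hmin⟩ : ∃ u, g^[u] j = i ∧ ∀ s < u, g^[s] j ≠ i :=
    ⟨Nat.find hex, Nat.find_spec hex, fun s hs => Nat.find_min hex hs⟩
  have hu0 : u ≠ 0 := by
    rintro rfl
    exact hij hu.symm
  have hj : ∀ s, 1 ≤ s → s ≤ u → g^[s] j ≠ j := by
    intro s hs1 hsu e
    refine hmin (u - s) (by omega) ?_
    conv_lhs => rw [← e]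
    rw [← Function.iterate_add_apply, Nat.sub_add_cancel hsu, hu]
  have hcl : ∀ t, ∃ s, 1 ≤ s ∧ s ≤ u ∧ (g * Equiv.swap i j)^[t] i = g^[s] j := by
    intro t
    induction t with
    | zero => exact ⟨u, by omega, le_refl u, hu.symm⟩
    | succ t ih =>
      obtain ⟨s, hs1, hsu, e⟩ := ih
      rw [Function.iterate_succ_apply', e]
      rcases hsu.lt_or_eq with hlt | rfl
      · exact ⟨s + 1, by omega, hlt, by
          rw [mul_swap_apply_of_ne (hmin s hlt) (hj s hs1 hsu), Function.iterate_succ_apply']⟩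
      · exact ⟨1, le_refl 1, hs1, by rw [hu, mul_swap_apply_left]; rfl⟩
  intro hs
  obtain ⟨t, -, ht⟩ := sameCycle_iff_iterate.1 hs
  obtain ⟨s, hs1, hsu, e⟩ := hcl t
  exact hj s hs1 hsu (e.symm.trans ht)

theorem minimalPeriod_mul_swap {g : Equiv.Perm ι} {i j : ι} (h : ¬ g.SameCycle i j) :
    minimalPeriod (g * Equiv.swap i j) i = minimalPeriod g i + minimalPeriod g j := by
  rw [← cycleLength_eq_minimalPeriod, ← cycleLength_eq_minimalPeriod,
    ← cycleLength_eq_minimalPeriod, cycleLength, cycleLength, cycleLength,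
    ← Finset.card_union_of_disjoint]
  · congr 1
    ext x
    simp [sameCycle_mul_swap_iff h]
  · rw [Finset.disjoint_left]
    intro x hx hx'
    simp only [Finset.mem_filter, Finset.mem_univ, true_and] at hx hx'
    exact h (hx.trans hx'.symm)

/-- The path from `i` for the merged cycle runs through the old cycle of `j` and then through that
of `i`. -/
theorem pathProd_mul_swap {R : Type*} [Ring R] (M : Matrix ι ι R) {g : Equiv.Perm ι} {i j : ι}
    (h : ¬ g.SameCycle i j) :
    pathProd M (g * Equiv.swap i j) i = pathProd M g i * M (g i) j * pathProd M g j := by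
  have h' : ¬ g.SameCycle j i := fun h' => h h'.symm
  have ha := minimalPeriod_pos g i
  have hb := minimalPeriod_pos g j
  have e : minimalPeriod g i + minimalPeriod g j - 1 =
      (minimalPeriod g i - 1 + 1) + (minimalPeriod g j - 1) := by omega
  have w1 : walk M (g * Equiv.swap i j) (minimalPeriod g j - 1) (g j) = pathProd M g j :=
    walk_congr (fun t ht => mul_swap_apply_iterate h ht) fun _ _ => rfl
  have w2 : walk M (g * Equiv.swap i j) (minimalPeriod g i - 1) (g i) = pathProd M g i := by
    rw [Equiv.swap_comm]
    exact walk_congr (fun t ht => mul_swap_apply_iterate h' ht) fun _ _ => rfl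
  have w3 : (g * Equiv.swap i j)^[minimalPeriod g j - 1] (g j) = j :=
    (iterate_congr fun t ht => mul_swap_apply_iterate h ht).trans (iterate_pred_minimalPeriod g j)
  rw [pathProd, minimalPeriod_mul_swap h, e, mul_swap_apply_left, walk_add, w1, w3, walk,
    mul_swap_apply_right, w2]

/-- The least elements of the cycles that contain neither `i` nor `j`. -/
def otherMins₂ (g : Equiv.Perm ι) (i j : ι) : Finset ι :=
  (otherMins g i).filter fun l => ¬ g.SameCycle j l

theorem mem_otherMins₂ {g : Equiv.Perm ι} {i j l : ι} :
    l ∈ otherMins₂ g i j ↔ (¬ g.SameCycle i l ∧ l ∈ cycleMins g) ∧ ¬ g.SameCycle j l := by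
  simp [otherMins₂, mem_otherMins, mem_cycleMins]

theorem otherMins_eq_insert {g : Equiv.Perm ι} {i j m : ι} (h : ¬ g.SameCycle i j)
    (hm : m ∈ cycleMins g) (hjm : g.SameCycle j m) :
    otherMins g i = insert m (otherMins₂ g i j) := by
  ext l
  rw [Finset.mem_insert, mem_otherMins₂, mem_otherMins, ← mem_cycleMins]
  constructor
  · intro hl
    by_cases hjl : g.SameCycle j l
    · exact Or.inl (eq_of_mem_cycleMins hl.2 hm (hjl.symm.trans hjm))
    · exact Or.inr ⟨hl, hjl⟩
  · rintro (rfl | hl)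
    · exact ⟨fun h' => h (h'.trans hjm.symm), hm⟩
    · exact hl.1

theorem otherMins_mul_swap {g : Equiv.Perm ι} {i j : ι} (h : ¬ g.SameCycle i j) :
    otherMins (g * Equiv.swap i j) i = otherMins₂ g i j := by
  ext l
  rw [mem_otherMins, mem_otherMins₂, sameCycle_mul_swap_iff h, not_or, mem_cycleMins]
  constructor
  · rintro ⟨⟨h1, h2⟩, h3⟩
    exact ⟨⟨h1, fun m hm => h3 m ((sameCycle_mul_swap_iff_of_not h1 h2).2 hm)⟩, h2⟩
  · rintro ⟨⟨h1, h3⟩, h2⟩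
    exact ⟨⟨h1, h2⟩, fun m hm => h3 m ((sameCycle_mul_swap_iff_of_not h1 h2).1 hm)⟩

theorem cycleSign_mul_swap {g : Equiv.Perm ι} {i j : ι} (h : ¬ g.SameCycle i j) :
    cycleSign (g * Equiv.swap i j) = - cycleSign g := by
  obtain ⟨m, hm, hjm⟩ := exists_mem_cycleMins g j
  have hn : m ∉ otherMins₂ g i j := fun h' => (mem_otherMins₂.1 h').2 hjm
  rw [cycleSign, cycleSign, card_cycleMins _ i, card_cycleMins g i, otherMins_mul_swap h,
    otherMins_eq_insert h hm hjm, Finset.card_insert_of_notMem hn]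
  ring

theorem weight_of_not_sameCycle (M : Matrix ι ι ℍ[ℝ]) {g : Equiv.Perm ι} {i j : ι}
    (h : ¬ g.SameCycle i j) :
    weight M g i =
      cycleSign g * (∏ l ∈ otherMins₂ g i j, (cycleProd M g l).re) * (cycleProd M g j).re := by
  obtain ⟨m, hm, hjm⟩ := exists_mem_cycleMins g j
  have hn : m ∉ otherMins₂ g i j := fun h' => (mem_otherMins₂.1 h').2 hjm
  rw [weight, otherMins_eq_insert h hm hjm, Finset.prod_insert hn, re_cycleProd_eq M hjm]
  ring

theorem weight_mul_swap (M : Matrix ι ι ℍ[ℝ]) {g : Equiv.Perm ι} {i j : ι}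
    (h : ¬ g.SameCycle i j) :
    weight M (g * Equiv.swap i j) i =
      -(cycleSign g * ∏ l ∈ otherMins₂ g i j, (cycleProd M g l).re) := by
  rw [weight, otherMins_mul_swap h, cycleSign_mul_swap h, neg_mul]
  congr 2
  refine Finset.prod_congr rfl fun l hl => ?_
  rw [mem_otherMins₂] at hl
  rw [cycleProd_congr (fun x hx => mul_swap_apply_of_not_sameCycle
    (fun h' => hl.1.1 (h'.trans hx.symm)) (fun h' => hl.2 (h'.trans hx.symm))) fun _ _ => rfl]

theorem weight_eq_zero {M : Matrix ι ι ℍ[ℝ]} {g : Equiv.Perm ι} {i x : ι}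
    (h : ¬ g.SameCycle i x) (hx : M (g x) x = 0) : weight M g i = 0 := by
  rw [weight_of_not_sameCycle M h,
    cycleProd_eq_zero (Equiv.Perm.SameCycle.refl g x) hx]
  simp

theorem weight_congr {M M' : Matrix ι ι ℍ[ℝ]} {g : Equiv.Perm ι} {i : ι}
    (h : ∀ x, ¬ g.SameCycle i x → M' (g x) x = M (g x) x) : weight M' g i = weight M g i := by
  rw [weight, weight]
  congr 1
  refine Finset.prod_congr rfl fun l hl => ?_
  rw [cycleProd_congr (fun _ _ => rfl) fun x hx => h x fun h' =>
    (mem_otherMins.1 hl).1 (h'.trans hx.symm)]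

end Swap

/-! ### Cofactor identities -/

section Cofactor

variable {ι : Type*} [Fintype ι] [LinearOrder ι]

/-- Replacing column `i` of a Hermitian matrix by another of its columns annihilates the column
determinant at `i`: the permutations `g` that separate `i` and `j` cancel against `g * swap i j`
once the cycle of `j` has been averaged over its two directions. -/
theorem sum_cofactor_mul_of_ne {M : Matrix ι ι ℍ[ℝ]} (hM : M.IsHermitian) {i j : ι} (hij : i ≠ j) :
    ∑ k, cofactor M i k * M k j = 0 := by
  rw [sum_cofactor_mul M i fun k => M k j]
  set T : Equiv.Perm ι → ℍ[ℝ] := fun g => weight M g i • (pathProd M g i * M (g i) j) with hT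
  have hsplit : ∑ g, T g =
      ∑ g : Equiv.Perm ι, if g.SameCycle i j then 0 else T g + T (g * Equiv.swap i j) := by
    have e1 : ∑ g : Equiv.Perm ι, (if g.SameCycle i j then T g else 0) =
        ∑ g : Equiv.Perm ι, if g.SameCycle i j then 0 else T (g * Equiv.swap i j) := by
      rw [← Equiv.sum_comp (Equiv.mulRight (Equiv.swap i j))]
      refine Finset.sum_congr rfl fun g _ => ?_
      rw [Equiv.coe_mulRight]
      by_cases h : g.SameCycle i j
      · rw [if_neg (not_sameCycle_mul_swap hij h), if_pos h]
      · rw [if_pos (sameCycle_mul_swap h), if_neg h]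
    calc ∑ g, T g = ∑ g : Equiv.Perm ι, (if g.SameCycle i j then 0 else T g) +
          ∑ g : Equiv.Perm ι, (if g.SameCycle i j then T g else 0) := by
          rw [← Finset.sum_add_distrib]
          refine Finset.sum_congr rfl fun g _ => ?_
          split_ifs <;> simp
      _ = _ := by
          rw [e1, ← Finset.sum_add_distrib]
          refine Finset.sum_congr rfl fun g _ => ?_
          split_ifs <;> simp
  have hpair : ∀ g : Equiv.Perm ι, ¬ g.SameCycle i j → T g + T (g * Equiv.swap i j) =
      (cycleSign g * ∏ l ∈ otherMins₂ g i j, (cycleProd M g l).re) •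
        (pathProd M g i * M (g i) j * (((cycleProd M g j).re : ℍ[ℝ]) - cycleProd M g j)) := by
    intro g h
    simp only [hT]
    rw [weight_mul_swap M h, pathProd_mul_swap M h, mul_swap_apply_left,
      weight_of_not_sameCycle M h, mul_assoc _ (pathProd M g j), ← cycleProd_eq_pathProd_mul,
      mul_sub, smul_sub, neg_smul, ← sub_eq_add_neg, mul_smul, Quaternion.mul_coe_eq_smul]
  rw [hsplit, ← Finset.sum_const_zero (ι := Equiv.Perm ι)]
  refine sum_eq_of_add_comp_eq (φ := rev j) (Function.Involutive.bijective (rev_rev j)) fun g => ?_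
  simp only [sameCycle_rev]
  by_cases h : g.SameCycle i j
  · simp [h]
  · have h' : ¬ g.SameCycle j i := fun h' => h h'.symm
    have hO : otherMins₂ (rev j g) i j = otherMins₂ g i j := by
      simp [otherMins₂, otherMins_congr fun _ _ => sameCycle_rev, sameCycle_rev]
    have hP : ∏ l ∈ otherMins₂ g i j, (cycleProd M (rev j g) l).re =
        ∏ l ∈ otherMins₂ g i j, (cycleProd M g l).re :=
      Finset.prod_congr rfl fun l hl => by
        rw [cycleProd_rev_of_not M (mem_otherMins₂.1 hl).2]
    rw [if_neg h, if_neg h, hpair g h, hpair (rev j g) (by rwa [sameCycle_rev]), hO, hP,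
      cycleSign_congr fun _ _ => sameCycle_rev, pathProd_rev_of_not M h', rev_apply_of_not h',
      cycleProd_rev hM, ← smul_add, ← mul_add, Quaternion.re_star, sub_add_sub_comm, add_star_eq]
    simp

/-- Off the diagonal, a cofactor of `M` is an expansion along column `j` of cofactors of the
matrix `M₀` obtained from `M` by making `j` an isolated index. -/
theorem cofactor_eq_neg_sum {M M₀ : Matrix ι ι ℍ[ℝ]} {i j : ι} (hij : i ≠ j)
    (h : ∀ x y, x ≠ j → y ≠ j → M₀ x y = M x y) (hc : ∀ x, x ≠ j → M₀ x j = 0) (h1 : M₀ j j = 1) :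
    cofactor M i j = - ∑ k, cofactor M₀ i k * M k j := by
  rw [sum_cofactor_mul M₀ i fun k => M k j, cofactor,
    ← Equiv.sum_comp (Equiv.mulRight (Equiv.swap i j)), ← Finset.sum_neg_distrib]
  refine Finset.sum_congr rfl fun g _ => ?_
  rw [Equiv.coe_mulRight, mul_swap_apply_left]
  by_cases hj : g j = j
  · have hs : ¬ g.SameCycle j i := fun hs => hij (hs.eq_of_left hj).symm
    have hs' : ¬ g.SameCycle i j := fun h' => hs h'.symm
    have hne : ∀ x, x ≠ j → g x ≠ j := fun x hx e => hx (g.injective (e.trans hj.symm))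
    have hw : weight M (g * Equiv.swap i j) i = - weight M₀ g i := by
      rw [weight_mul_swap M hs', weight_of_not_sameCycle M₀ hs', cycleProd_of_apply_eq M₀ hj, h1,
        Quaternion.re_one, mul_one]
      congr 2
      refine Finset.prod_congr rfl fun l hl => ?_
      rw [mem_otherMins₂] at hl
      rw [cycleProd_congr (fun _ _ => rfl) fun x hx => ?_]
      have hxj : x ≠ j := fun e => hl.2 (e ▸ hx.symm)
      exact (h _ _ (hne x hxj) hxj).symm
    have hp : pathProd M₀ g i = pathProd M g i := by
      refine pathProd_congr fun x hx _ => ?_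
      have hxj : x ≠ j := fun e => hs' (e ▸ hx)
      exact h _ _ (hne x hxj) hxj
    rw [if_pos hj, hw, pathProd_mul_swap M hs', pathProd_of_apply_eq M hj, mul_one, neg_smul, hp]
  · have h0 : M₀ (g j) j = 0 := hc _ hj
    rw [if_neg hj]
    by_cases hs : g.SameCycle i j
    · rw [pathProd_eq_zero hs hij.symm h0]
      simp
    · rw [weight_eq_zero hs h0]
      simp

/-- A diagonal cofactor of `M` is the determinant of the matrix `M₀` obtained from `M` by making
`i` an isolated index. -/
theorem cofactor_self {M M₀ : Matrix ι ι ℍ[ℝ]} {i : ι}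
    (h : ∀ x y, x ≠ i → y ≠ i → M₀ x y = M x y) (hc : ∀ x, x ≠ i → M₀ x i = 0) (h1 : M₀ i i = 1) :
    cofactor M i i = (realDet M₀ : ℍ[ℝ]) := by
  rw [cofactor, realDet, coe_sum]
  refine Finset.sum_congr rfl fun g _ => ?_
  rw [← weight_mul_re M₀ g i]
  by_cases hi : g i = i
  · rw [if_pos hi, cycleProd_of_apply_eq M₀ hi, h1, pathProd_of_apply_eq M hi]
    have hw : weight M₀ g i = weight M g i := by
      refine weight_congr fun x hx => ?_
      have hxi : x ≠ i := fun e => hx (e ▸ Equiv.Perm.SameCycle.refl g x)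
      exact h _ _ (fun e => hxi (g.injective (e.trans hi.symm))) hxi
    rw [hw, Quaternion.re_one, mul_one, ← Quaternion.coe_mul_eq_smul, mul_one]
  · rw [if_neg hi, cycleProd_eq_zero (Equiv.Perm.SameCycle.refl g i) (hc _ hi)]
    simp

end Cofactor

/-! ### Principal submatrices inside the full index set -/

section Padded

variable {n : ℕ}

/-- The matrix that agrees with `A` on the rows and columns in `β` and with the identity matrix
elsewhere. For Hermitian `A` it has the same determinant as the principal submatrix, without a
change of the index type. -/
noncomputable def padded (A : Matrix (Fin n) (Fin n) ℍ[ℝ]) (β : Finset (Fin n)) :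
    Matrix (Fin n) (Fin n) ℍ[ℝ] :=
  fun x y => if x ∈ β ∧ y ∈ β then A x y else if x = y then 1 else 0

theorem padded_apply_of_mem {A : Matrix (Fin n) (Fin n) ℍ[ℝ]} {β : Finset (Fin n)} {x y : Fin n}
    (hx : x ∈ β) (hy : y ∈ β) : padded A β x y = A x y := if_pos ⟨hx, hy⟩

theorem padded_apply_self_of_notMem (A : Matrix (Fin n) (Fin n) ℍ[ℝ]) {β : Finset (Fin n)}
    {x : Fin n} (hx : x ∉ β) : padded A β x x = 1 := by
  simp [padded, hx]

theorem padded_apply_of_notMem (A : Matrix (Fin n) (Fin n) ℍ[ℝ]) {β : Finset (Fin n)} {x y : Fin n}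
    (hy : y ∉ β) (h : x ≠ y) : padded A β x y = 0 := by
  simp [padded, hy, h]

theorem isHermitian_padded {A : Matrix (Fin n) (Fin n) ℍ[ℝ]} (hA : A.IsHermitian)
    (β : Finset (Fin n)) : (padded A β).IsHermitian := by
  refine Matrix.ext fun x y => ?_
  by_cases h : x ∈ β ∧ y ∈ β
  · simp [Matrix.conjTranspose_apply, padded, h, hA.apply]
  · have h' : ¬ (y ∈ β ∧ x ∈ β) := fun h' => h h'.symm
    rw [Matrix.conjTranspose_apply, padded, padded, if_neg h, if_neg h']
    by_cases e : x = y
    · simp [e]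
    · simp [e, Ne.symm e]

variable {β : Finset (Fin n)}

theorem iterate_ofSubtype (g : Equiv.Perm {x // x ∈ β}) (x : {x // x ∈ β}) (t : ℕ) :
    (Equiv.Perm.ofSubtype g)^[t] (x : Fin n) = (g^[t] x : {x // x ∈ β}) := by
  induction t generalizing x with
  | zero => rfl
  | succ t ih => rw [Function.iterate_succ_apply, Equiv.Perm.ofSubtype_apply_coe, ih]; rfl

theorem minimalPeriod_ofSubtype (g : Equiv.Perm {x // x ∈ β}) (x : {x // x ∈ β}) :
    minimalPeriod (Equiv.Perm.ofSubtype g) (x : Fin n) = minimalPeriod g x := by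
  rw [Function.minimalPeriod_eq_minimalPeriod_iff]
  intro t
  rw [Function.IsPeriodicPt, Function.IsFixedPt, iterate_ofSubtype, Subtype.coe_inj]
  rfl

theorem sameCycle_ofSubtype (g : Equiv.Perm {x // x ∈ β}) (x y : {x // x ∈ β}) :
    (Equiv.Perm.ofSubtype g).SameCycle (x : Fin n) y ↔ g.SameCycle x y := by
  rw [sameCycle_iff_iterate, sameCycle_iff_iterate, minimalPeriod_ofSubtype]
  simp only [iterate_ofSubtype, Subtype.coe_inj]

theorem mem_of_sameCycle_ofSubtype {g : Equiv.Perm {x // x ∈ β}} {x : {x // x ∈ β}} {y : Fin n}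
    (h : (Equiv.Perm.ofSubtype g).SameCycle (x : Fin n) y) : y ∈ β := by
  obtain ⟨t, -, rfl⟩ := sameCycle_iff_iterate.1 h
  rw [iterate_ofSubtype]
  exact Subtype.coe_prop _

theorem walk_ofSubtype (A : Matrix (Fin n) (Fin n) ℍ[ℝ]) (g : Equiv.Perm {x // x ∈ β}) (m : ℕ)
    (x : {x // x ∈ β}) :
    walk (padded A β) (Equiv.Perm.ofSubtype g) m (x : Fin n) = walk (principal A β) g m x := by
  induction m generalizing x with
  | zero => rfl
  | succ m ih =>
    rw [walk, walk, Equiv.Perm.ofSubtype_apply_coe, ih,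
      padded_apply_of_mem (Subtype.coe_prop _) (Subtype.coe_prop _)]
    rfl

theorem cycleProd_ofSubtype (A : Matrix (Fin n) (Fin n) ℍ[ℝ]) (g : Equiv.Perm {x // x ∈ β})
    (x : {x // x ∈ β}) :
    cycleProd (padded A β) (Equiv.Perm.ofSubtype g) x = cycleProd (principal A β) g x := by
  rw [cycleProd, cycleProd, minimalPeriod_ofSubtype, walk_ofSubtype]

theorem pathProd_ofSubtype (A : Matrix (Fin n) (Fin n) ℍ[ℝ]) (g : Equiv.Perm {x // x ∈ β})
    (x : {x // x ∈ β}) :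
    pathProd (padded A β) (Equiv.Perm.ofSubtype g) x = pathProd (principal A β) g x := by
  rw [pathProd, pathProd, minimalPeriod_ofSubtype, Equiv.Perm.ofSubtype_apply_coe, walk_ofSubtype]

theorem cycleMins_ofSubtype (g : Equiv.Perm {x // x ∈ β}) :
    cycleMins (Equiv.Perm.ofSubtype g) = (cycleMins g).map (Function.Embedding.subtype _) ∪ βᶜ := by
  ext l
  rw [Finset.mem_union, Finset.mem_compl, mem_cycleMins]
  by_cases hl : l ∈ β
  · simp only [hl, not_true, or_false, Finset.mem_map, mem_cycleMins]
    constructor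
    · exact fun h => ⟨⟨l, hl⟩, fun m hm => h m ((sameCycle_ofSubtype g ⟨l, hl⟩ m).2 hm), rfl⟩
    · rintro ⟨l, h, rfl⟩ m hm
      exact h ⟨m, mem_of_sameCycle_ofSubtype hm⟩
        ((sameCycle_ofSubtype g l ⟨m, mem_of_sameCycle_ofSubtype hm⟩).1 hm)
  · simp only [hl, not_false_eq_true, or_true, iff_true]
    intro m hm
    exact (hm.eq_of_left (Equiv.Perm.ofSubtype_apply_of_not_mem g hl)).le

theorem otherMins_ofSubtype (g : Equiv.Perm {x // x ∈ β}) (i : {x // x ∈ β}) :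
    otherMins (Equiv.Perm.ofSubtype g) (i : Fin n) =
      (otherMins g i).map (Function.Embedding.subtype _) ∪ βᶜ := by
  ext l
  have h := Finset.ext_iff.1 (cycleMins_ofSubtype g) l
  rw [Finset.mem_union, Finset.mem_compl] at h ⊢
  rw [mem_otherMins, ← mem_cycleMins, h]
  by_cases hl : l ∈ β
  · have := sameCycle_ofSubtype g i ⟨l, hl⟩
    simp only [hl, not_true, or_false, Finset.mem_map, mem_otherMins, ← mem_cycleMins]
    constructor
    · rintro ⟨h1, l', h2, rfl⟩
      exact ⟨l', ⟨fun h' => h1 (this.2 h'), h2⟩, rfl⟩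
    · rintro ⟨l', ⟨h1, h2⟩, rfl⟩
      exact ⟨fun h' => h1 (this.1 h'), l', h2, rfl⟩
  · have : ¬ (Equiv.Perm.ofSubtype g).SameCycle (i : Fin n) l := fun h' =>
      hl (mem_of_sameCycle_ofSubtype h')
    simp [hl, this]

theorem disjoint_map_subtype_compl (S : Finset {x // x ∈ β}) :
    Disjoint (S.map (Function.Embedding.subtype _)) βᶜ := by
  rw [Finset.disjoint_left]
  intro x hx
  obtain ⟨y, -, rfl⟩ := Finset.mem_map.1 hx
  simp

theorem cycleSign_ofSubtype (g : Equiv.Perm {x // x ∈ β}) :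
    cycleSign (Equiv.Perm.ofSubtype g) = cycleSign g := by
  have hc : βᶜ.card + β.card = n := by
    rw [add_comm, Finset.card_add_card_compl, Fintype.card_fin]
  rw [cycleSign, cycleSign, cycleMins_ofSubtype,
    Finset.card_union_of_disjoint (disjoint_map_subtype_compl _), Finset.card_map,
    Fintype.card_coe, Fintype.card_fin,
    show n + ((cycleMins g).card + βᶜ.card) = 2 * βᶜ.card + (β.card + (cycleMins g).card) by omega,
    pow_add, pow_mul]
  simp

theorem prod_re_cycleProd_ofSubtype (A : Matrix (Fin n) (Fin n) ℍ[ℝ]) (g : Equiv.Perm {x // x ∈ β})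
    (S : Finset {x // x ∈ β}) :
    ∏ l ∈ S.map (Function.Embedding.subtype _) ∪ βᶜ,
        (cycleProd (padded A β) (Equiv.Perm.ofSubtype g) l).re =
      ∏ l ∈ S, (cycleProd (principal A β) g l).re := by
  rw [Finset.prod_union (disjoint_map_subtype_compl S), Finset.prod_map,
    Finset.prod_eq_one (s := βᶜ), mul_one]
  · exact Finset.prod_congr rfl fun l _ => by
      rw [Function.Embedding.coe_subtype, cycleProd_ofSubtype]
  · intro l hl
    rw [Finset.mem_compl] at hl
    rw [cycleProd_of_apply_eq _ (Equiv.Perm.ofSubtype_apply_of_not_mem g hl),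
      padded_apply_self_of_notMem A hl, Quaternion.re_one]

theorem weight_ofSubtype (A : Matrix (Fin n) (Fin n) ℍ[ℝ]) (g : Equiv.Perm {x // x ∈ β})
    (i : {x // x ∈ β}) :
    weight (padded A β) (Equiv.Perm.ofSubtype g) i = weight (principal A β) g i := by
  rw [weight, weight, otherMins_ofSubtype, prod_re_cycleProd_ofSubtype, cycleSign_ofSubtype]

/-- A sum over permutations whose summands vanish unless the complement of `β` is fixed pointwise
is a sum over the permutations of `β`. -/
theorem sum_perm_eq_sum_ofSubtype {V : Type*} [AddCommMonoid V] (F : Equiv.Perm (Fin n) → V)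
    (hF : ∀ g x, x ∉ β → g x ≠ x → F g = 0) :
    ∑ g : Equiv.Perm (Fin n), F g =
      ∑ g : Equiv.Perm {x // x ∈ β}, F (Equiv.Perm.ofSubtype g) := by
  classical
  symm
  refine Finset.sum_of_injOn (fun g => Equiv.Perm.ofSubtype g)
    Equiv.Perm.ofSubtype_injective.injOn (fun _ _ => Finset.mem_coe.2 (Finset.mem_univ _))
    (fun g _ hg => ?_) fun _ _ => rfl
  by_contra h
  have hfix : ∀ x, g x ≠ x → x ∈ β := by
    intro x hx
    by_contra hxβ
    exact h (hF g x hxβ hx)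
  have hmem : ∀ x, g x ∈ β ↔ x ∈ β := by
    intro x
    by_cases hx : g x = x
    · rw [hx]
    · exact ⟨fun _ => hfix x hx, fun _ => hfix _ fun e => hx (g.injective e)⟩
  exact hg ⟨g.subtypePerm hmem, by simp, Equiv.Perm.ofSubtype_subtypePerm hmem hfix⟩

/-- The decidability instance is a free implicit argument, so that the lemma also applies with the
instance coming from the linear order. -/
theorem principal_updateCol {_ : DecidableEq {x // x ∈ β}} (A : Matrix (Fin n) (Fin n) ℍ[ℝ])
    (i : {x // x ∈ β}) (b : Fin n → ℍ[ℝ]) :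
    principal (A.updateCol i b) β = (principal A β).updateCol i fun x => b x := by
  refine Matrix.ext fun x y => ?_
  simp [principal, Matrix.updateCol_apply]

theorem isHermitian_principal {A : Matrix (Fin n) (Fin n) ℍ[ℝ]} (hA : A.IsHermitian)
    (β : Finset (Fin n)) : (principal A β).IsHermitian :=
  hA.submatrix _

theorem cdet_principal_updateCol {A : Matrix (Fin n) (Fin n) ℍ[ℝ]} (hA : A.IsHermitian)
    {i : Fin n} (hi : i ∈ β) (b : Fin n → ℍ[ℝ]) :
    cdet ⟨i, hi⟩ (principal (A.updateCol i b) β) = ∑ k, cofactor (padded A β) i k * b k := by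
  rw [principal_updateCol A ⟨i, hi⟩ b, cdet_updateCol (isHermitian_principal hA β),
    sum_cofactor_mul, sum_perm_eq_sum_ofSubtype (β := β)]
  · refine Finset.sum_congr rfl fun g _ => ?_
    rw [weight_ofSubtype A g ⟨i, hi⟩, pathProd_ofSubtype A g ⟨i, hi⟩,
      Equiv.Perm.ofSubtype_apply_coe g ⟨i, hi⟩]
  · intro g x hx hgx
    have h0 : padded A β (g x) x = 0 := padded_apply_of_notMem A hx hgx
    by_cases hs : g.SameCycle i x
    · rw [pathProd_eq_zero hs (fun e => hx (e ▸ hi)) h0]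
      simp
    · rw [weight_eq_zero hs h0, zero_smul]

theorem cofactor_padded_of_notMem (A : Matrix (Fin n) (Fin n) ℍ[ℝ]) {i k : Fin n} (hik : i ≠ k)
    (hk : k ∉ β) : cofactor (padded A β) i k = 0 := by
  refine Finset.sum_eq_zero fun g _ => ?_
  split_ifs with h
  · have hs : g.SameCycle i k := by simpa [h] using sameCycle_iterate g i 1
    have hgk : g k ≠ k := fun e => hik (g.injective (h.trans e.symm))
    rw [pathProd_eq_zero hs hik.symm (padded_apply_of_notMem A hk hgk), smul_zero]
  · rfl

theorem hdet_principal {A : Matrix (Fin n) (Fin n) ℍ[ℝ]} (hA : A.IsHermitian)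
    (β : Finset (Fin n)) : hdet (principal A β) = (realDet (padded A β) : ℍ[ℝ]) := by
  rw [hdet_eq_realDet (isHermitian_principal hA β), realDet, realDet,
    sum_perm_eq_sum_ofSubtype (β := β)]
  · congr 1
    refine Finset.sum_congr rfl fun g _ => ?_
    rw [cycleMins_ofSubtype, prod_re_cycleProd_ofSubtype, cycleSign_ofSubtype]
  · intro g x hx hgx
    rw [← weight_mul_re _ g x, cycleProd_eq_zero (Equiv.Perm.SameCycle.refl g x)
      (padded_apply_of_notMem A hx hgx)]
    simp

end Padded

/-! ### Sums of principal minors and of cofactors -/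

section Newton

variable {n : ℕ}

/-- The sum of the principal minors of order `s` as a real number. -/
noncomputable def minorSum (B : Matrix (Fin n) (Fin n) ℍ[ℝ]) (s : ℕ) : ℝ :=
  ∑ β ∈ Finset.univ.powersetCard s, realDet (padded B β)

/-- The matrix of the sums of the cofactors of all principal submatrices of order `s`. It plays
the part of a coefficient of the adjugate of `t + B`. -/
noncomputable def cofactorSum (B : Matrix (Fin n) (Fin n) ℍ[ℝ]) (s : ℕ) :
    Matrix (Fin n) (Fin n) ℍ[ℝ] :=
  fun i k => ∑ β ∈ Finset.univ.powersetCard s, if i ∈ β then cofactor (padded B β) i k else 0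

/-- Removing `j` is a bijection from the sets of size `s + 1` that contain `j` to the sets of size
`s` that do not. -/
theorem sum_powersetCard_erase {V : Type*} [AddCommMonoid V] (s : ℕ) (j : Fin n)
    (f : Finset (Fin n) → V) :
    ∑ γ ∈ Finset.univ.powersetCard (s + 1), (if j ∈ γ then f (γ.erase j) else 0) =
      ∑ β ∈ Finset.univ.powersetCard s, if j ∉ β then f β else 0 := by
  rw [← Finset.sum_filter, ← Finset.sum_filter]
  refine Finset.sum_bij' (fun γ _ => γ.erase j) (fun β _ => insert j β) ?_ ?_ ?_ ?_ ?_
  · intro γ hγ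
    simp only [Finset.mem_filter, Finset.mem_powersetCard_univ] at hγ ⊢
    rw [Finset.card_erase_of_mem hγ.2, hγ.1]
    simp
  · intro β hβ
    simp only [Finset.mem_filter, Finset.mem_powersetCard_univ] at hβ ⊢
    rw [Finset.card_insert_of_notMem hβ.2, hβ.1]
    simp
  · intro γ hγ
    exact Finset.insert_erase (Finset.mem_filter.1 hγ).2
  · intro β hβ
    exact Finset.erase_insert (Finset.mem_filter.1 hβ).2
  · intro γ _
    rfl

theorem cofactor_padded_self (B : Matrix (Fin n) (Fin n) ℍ[ℝ]) (γ : Finset (Fin n)) (i : Fin n) :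
    cofactor (padded B γ) i i = (realDet (padded B (γ.erase i)) : ℍ[ℝ]) := by
  refine cofactor_self (fun x y hx hy => ?_)
    (fun x hx => padded_apply_of_notMem B (Finset.notMem_erase i γ) hx)
    (padded_apply_self_of_notMem B (Finset.notMem_erase i γ))
  simp [padded, hx, hy]

theorem cofactor_padded_of_ne (B : Matrix (Fin n) (Fin n) ℍ[ℝ]) {γ : Finset (Fin n)} {i j : Fin n}
    (hij : i ≠ j) (hi : i ∈ γ) (hj : j ∈ γ) :
    cofactor (padded B γ) i j = - ∑ k, cofactor (padded B (γ.erase j)) i k * B k j := by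
  rw [cofactor_eq_neg_sum (M₀ := padded B (γ.erase j)) hij (fun x y hx hy => by
      simp [padded, hx, hy])
    (fun x hx => padded_apply_of_notMem B (Finset.notMem_erase j γ) hx)
    (padded_apply_self_of_notMem B (Finset.notMem_erase j γ))]
  congr 1
  refine Finset.sum_congr rfl fun k _ => ?_
  by_cases hk : k ∈ γ
  · rw [padded_apply_of_mem hk hj]
  · rw [cofactor_padded_of_notMem B (by rintro rfl; exact hk hi) fun h =>
        hk (Finset.mem_of_mem_erase h),
      zero_mul, zero_mul]

theorem sum_cofactor_padded_mul {B : Matrix (Fin n) (Fin n) ℍ[ℝ]} (hB : B.IsHermitian)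
    {β : Finset (Fin n)} {i j : Fin n} (hi : i ∈ β) (hj : j ∈ β) :
    ∑ k, cofactor (padded B β) i k * B k j =
      if i = j then (realDet (padded B β) : ℍ[ℝ]) else 0 := by
  have h : ∑ k, cofactor (padded B β) i k * B k j =
      ∑ k, cofactor (padded B β) i k * padded B β k j := by
    refine Finset.sum_congr rfl fun k _ => ?_
    by_cases hk : k ∈ β
    · rw [padded_apply_of_mem hk hj]
    · rw [cofactor_padded_of_notMem B (by rintro rfl; exact hk hi) hk, zero_mul, zero_mul]
  rw [h]
  split_ifs with hij
  · rw [← hij, sum_cofactor_mul_self (isHermitian_padded hB β)]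
  · exact sum_cofactor_mul_of_ne (isHermitian_padded hB β) hij

theorem cofactorSum_mul_apply (B C : Matrix (Fin n) (Fin n) ℍ[ℝ]) (s : ℕ) (i j : Fin n) :
    (cofactorSum B s * C) i j = ∑ β ∈ Finset.univ.powersetCard s,
      if i ∈ β then ∑ k, cofactor (padded B β) i k * C k j else 0 := by
  simp only [Matrix.mul_apply, cofactorSum, Finset.sum_mul]
  rw [Finset.sum_comm]
  refine Finset.sum_congr rfl fun β _ => ?_
  split_ifs <;> simp

theorem cofactorSum_succ_self (B : Matrix (Fin n) (Fin n) ℍ[ℝ]) (s : ℕ) (i : Fin n) :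
    cofactorSum B (s + 1) i i = ∑ β ∈ Finset.univ.powersetCard s,
      if i ∉ β then (realDet (padded B β) : ℍ[ℝ]) else 0 := by
  rw [← sum_powersetCard_erase s i fun β => (realDet (padded B β) : ℍ[ℝ]), cofactorSum]
  simp only [cofactor_padded_self]

/-- The recursion between the coefficients of the determinant and of the adjugate of `t + B`. -/
theorem cofactorSum_mul_add {B : Matrix (Fin n) (Fin n) ℍ[ℝ]} (hB : B.IsHermitian) (s : ℕ) :
    cofactorSum B s * B + cofactorSum B (s + 1) = minorSum B s • 1 := by
  refine Matrix.ext fun i j => ?_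
  rw [Matrix.add_apply, Matrix.smul_apply, cofactorSum_mul_apply]
  by_cases hij : i = j
  · subst hij
    rw [cofactorSum_succ_self, ← Finset.sum_add_distrib, Matrix.one_apply_eq,
      ← Quaternion.coe_mul_eq_smul, mul_one, minorSum, coe_sum]
    refine Finset.sum_congr rfl fun β _ => ?_
    by_cases hi : i ∈ β
    · simp [hi, sum_cofactor_padded_mul hB hi hi]
    · simp [hi]
  · have h2 : cofactorSum B (s + 1) i j = ∑ γ ∈ Finset.univ.powersetCard (s + 1),
        if j ∈ γ then (if i ∈ γ.erase j then
          - ∑ k, cofactor (padded B (γ.erase j)) i k * B k j else 0) else 0 := by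
      refine Finset.sum_congr rfl fun γ _ => ?_
      by_cases hi : i ∈ γ
      · by_cases hj : j ∈ γ
        · simp [hi, hj, hij, cofactor_padded_of_ne B hij hi hj]
        · simp [hj, cofactor_padded_of_notMem B hij hj]
      · simp [hi]
    rw [h2, sum_powersetCard_erase s j fun β => if i ∈ β then
      - ∑ k, cofactor (padded B β) i k * B k j else 0, ← Finset.sum_add_distrib,
      Matrix.one_apply_ne hij, smul_zero]
    refine Finset.sum_eq_zero fun β _ => ?_
    by_cases hi : i ∈ β
    · by_cases hj : j ∈ β
      · simp [hi, hj, sum_cofactor_padded_mul hB hi hj, hij]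
      · simp [hi, hj]
    · simp [hi]

theorem trace_cofactorSum_succ (B : Matrix (Fin n) (Fin n) ℍ[ℝ]) (s : ℕ) :
    (cofactorSum B (s + 1)).trace = (((n : ℝ) - s) * minorSum B s : ℝ) := by
  simp only [Matrix.trace, Matrix.diag_apply, cofactorSum_succ_self]
  rw [Finset.sum_comm, minorSum, Finset.mul_sum, coe_sum]
  refine Finset.sum_congr rfl fun β hβ => ?_
  have hs : β.card = s := Finset.mem_powersetCard_univ.1 hβ
  have hn : β.card ≤ n := by simpa using Finset.card_le_univ β
  have hc : (Finset.univ.filter fun i => i ∉ β).card = n - s := by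
    have e : (Finset.univ.filter fun i => i ∉ β) = βᶜ := by
      ext i
      simp
    rw [e, Finset.card_compl, Fintype.card_fin, hs]
  rw [← Finset.sum_filter, Finset.sum_const, hc, nsmul_eq_mul, Quaternion.coe_mul,
    Nat.cast_sub (hs ▸ hn)]
  push_cast
  rfl

theorem cofactorSum_eq_zero (B : Matrix (Fin n) (Fin n) ℍ[ℝ]) {s : ℕ} (hs : n < s) :
    cofactorSum B s = 0 := by
  refine Matrix.ext fun i k => ?_
  rw [cofactorSum, Finset.powersetCard_eq_empty.2 (by simpa using hs)]
  rfl

theorem minorSum_eq_zero (B : Matrix (Fin n) (Fin n) ℍ[ℝ]) {s : ℕ} (hs : n < s) :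
    minorSum B s = 0 := by
  rw [minorSum, Finset.powersetCard_eq_empty.2 (by simpa using hs), Finset.sum_empty]

theorem minorSum_zero {B : Matrix (Fin n) (Fin n) ℍ[ℝ]} (hB : B.IsHermitian) :
    minorSum B 0 = 1 := by
  have h := hdet_principal hB ∅
  rw [hdet, dif_neg (by simp [Finset.univ_eq_empty])] at h
  rw [minorSum, Finset.powersetCard_zero, Finset.sum_singleton]
  exact (Quaternion.coe_injective (by rw [Quaternion.coe_one, h])).symm

/-- The order `r` is found as the largest `m` with a nonzero sum of principal minors: there the
recursion gives `cofactorSum (m + 1) = minorSum m • (1 - A * G)`, and comparing the real parts of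
the traces yields `m = r`. -/
theorem cofactorSum_mul_eq_smul {A G : Matrix (Fin n) (Fin n) ℍ[ℝ]} (hA : A.IsHermitian)
    (h1 : A * A * G = A) (h2 : G * A * G = G) (h3 : A * G = G * A) {r : ℕ}
    (hr : (A * G).trace.re = r) :
    minorSum (A ^ 2) r ≠ 0 ∧ cofactorSum (A ^ 2) r * A = minorSum (A ^ 2) r • G := by
  have hB : (A ^ 2).IsHermitian := hA.pow 2
  set B := A ^ 2 with hBdef
  have hBA : B = A * A := sq A
  have hBG : B * G = A := by rw [hBA, h1]
  have hPG : A * G * G = G := by rw [h3, h2]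
  have hBP : B * (A * G) = B := by rw [h3, ← mul_assoc, hBG, hBA]
  obtain ⟨m, hm0, hm⟩ : ∃ m, minorSum B m ≠ 0 ∧ ∀ s, m < s → minorSum B s = 0 := by
    classical
    refine ⟨Nat.findGreatest (fun s => minorSum B s ≠ 0) n, ?_, fun s hs => ?_⟩
    · exact Nat.findGreatest_spec (P := fun s => minorSum B s ≠ 0) (Nat.zero_le n)
        (by rw [minorSum_zero hB]; exact one_ne_zero)
    · by_cases hsn : s ≤ n
      · exact not_not.1 (Nat.findGreatest_is_greatest hs hsn)
      · exact minorSum_eq_zero B (by omega)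
  -- Downwards induction from order `n + 1`: above order `m` the cofactor sums vanish on the range
  -- of `A`.
  have hvan : ∀ k s, n < s + k → m < s → cofactorSum B s * (A * G) = 0 := by
    intro k
    induction k with
    | zero => intro s hs _; rw [cofactorSum_eq_zero B (by omega), zero_mul]
    | succ k ih =>
      intro s hs hms
      have hrec := cofactorSum_mul_add hB s
      rw [hm s hms, zero_smul] at hrec
      have hnext := ih (s + 1) (by omega) (by omega)
      calc cofactorSum B s * (A * G) = cofactorSum B s * B * (G * G) := by
            rw [mul_assoc, ← mul_assoc B, hBG]
        _ = -(cofactorSum B (s + 1) * (A * G * G * G)) := by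
            rw [eq_neg_of_add_eq_zero_left hrec, neg_mul, hPG]
        _ = -(cofactorSum B (s + 1) * (A * G) * (G * G)) := by simp only [mul_assoc]
        _ = 0 := by rw [hnext, zero_mul, neg_zero]
  have hrec := cofactorSum_mul_add hB m
  have hC : cofactorSum B (m + 1) = minorSum B m • (1 - A * G) := by
    have h := congrArg (· * (1 - A * G)) hrec
    simp only [add_mul, mul_assoc, mul_sub B, mul_one, hBP, sub_self, mul_zero, zero_add] at h
    rw [mul_sub, mul_one, hvan (n + 1) (m + 1) (by omega) (by omega), sub_zero, smul_mul_assoc,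
      one_mul] at h
    exact h
  have htr := trace_cofactorSum_succ B m
  have hmr : m = r := by
    rw [hC, Matrix.trace_smul, Matrix.trace_sub, Matrix.trace_one, Fintype.card_fin] at htr
    have h := congrArg (fun q : ℍ[ℝ] => q.re) htr
    simp only [Quaternion.re_smul, Quaternion.re_sub, hr, Quaternion.re_coe, Quaternion.re_natCast,
      smul_eq_mul] at h
    rw [mul_comm] at h
    have h' := mul_right_cancel₀ hm0 h
    exact_mod_cast (sub_right_injective h').symm
  subst hmr
  refine ⟨hm0, ?_⟩
  have hCB : cofactorSum B m * B = minorSum B m • (A * G) := by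
    rw [hC, smul_sub, add_sub_assoc'] at hrec
    simpa [sub_eq_iff_eq_add, add_comm] using hrec
  calc cofactorSum B m * A = cofactorSum B m * B * G := by rw [mul_assoc, hBG]
    _ = minorSum B m • G := by rw [hCB, smul_mul_assoc, hPG]

end Newton

/-! ### Column spans, rank and trace -/

section Rank

variable {n : ℕ}

/-- The right vector space spanned by the columns. -/
noncomputable def colSpan (A : Matrix (Fin n) (Fin n) ℍ[ℝ]) : Submodule ℍ[ℝ]ᵐᵒᵖ (Fin n → ℍ[ℝ]) :=
  Submodule.span ℍ[ℝ]ᵐᵒᵖ (Set.range fun j => A.col j)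

theorem qrank_eq_finrank_colSpan (A : Matrix (Fin n) (Fin n) ℍ[ℝ]) :
    qrank A = Module.finrank ℍ[ℝ]ᵐᵒᵖ (colSpan A) := rfl

theorem mem_colSpan_iff {A : Matrix (Fin n) (Fin n) ℍ[ℝ]} {v : Fin n → ℍ[ℝ]} :
    v ∈ colSpan A ↔ ∃ w, A *ᵥ w = v := by
  rw [colSpan, Submodule.mem_span_range_iff_exists_fun]
  constructor
  · rintro ⟨c, rfl⟩
    refine ⟨fun k => (c k).unop, funext fun i => ?_⟩
    simp [Matrix.mulVec, dotProduct, Finset.sum_apply]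
  · rintro ⟨w, rfl⟩
    refine ⟨fun k => MulOpposite.op (w k), funext fun i => ?_⟩
    simp [Matrix.mulVec, dotProduct, Finset.sum_apply]

theorem colSpan_mul_le (A X : Matrix (Fin n) (Fin n) ℍ[ℝ]) : colSpan (A * X) ≤ colSpan A := by
  intro v hv
  obtain ⟨w, rfl⟩ := mem_colSpan_iff.1 hv
  exact mem_colSpan_iff.2 ⟨X *ᵥ w, by rw [Matrix.mulVec_mulVec]⟩

theorem exists_mul_eq_of_colSpan_le {A C : Matrix (Fin n) (Fin n) ℍ[ℝ]}
    (h : colSpan C ≤ colSpan A) : ∃ X, A * X = C := by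
  have hex : ∀ j, ∃ w, A *ᵥ w = C.col j := fun j =>
    mem_colSpan_iff.1 (h (Submodule.subset_span ⟨j, rfl⟩))
  choose w hw using hex
  refine ⟨fun k j => w j k, Matrix.ext fun i j => ?_⟩
  exact congrFun (hw j) i

theorem re_sum {α : Type*} (s : Finset α) (f : α → ℍ[ℝ]) :
    (∑ x ∈ s, f x).re = ∑ x ∈ s, (f x).re := by
  classical
  induction s using Finset.induction_on with
  | empty => simp
  | insert a s ha ih => rw [Finset.sum_insert ha, Finset.sum_insert ha, Quaternion.re_add, ih]

/-- The real part of the trace of an idempotent quaternion matrix is its rank: factor it as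
`U * W` through a basis of the column span; then `W * U = 1`. -/
theorem re_trace_of_idempotent {P : Matrix (Fin n) (Fin n) ℍ[ℝ]} (hP : P * P = P) :
    P.trace.re = qrank P := by
  rw [qrank_eq_finrank_colSpan]
  set V := colSpan P with hV
  have hfin : Module.Finite ℍ[ℝ]ᵐᵒᵖ V :=
    FiniteDimensional.span_of_finite _ (Set.finite_range _)
  let b := Module.finBasis ℍ[ℝ]ᵐᵒᵖ V
  have hcol : ∀ j, P.col j ∈ V := fun j => Submodule.subset_span ⟨j, rfl⟩
  let U : Matrix (Fin n) (Fin (Module.finrank ℍ[ℝ]ᵐᵒᵖ V)) ℍ[ℝ] := fun i k => (b k : Fin n → ℍ[ℝ]) i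
  let W : Matrix (Fin (Module.finrank ℍ[ℝ]ᵐᵒᵖ V)) (Fin n) ℍ[ℝ] :=
    fun k j => (b.repr ⟨P.col j, hcol j⟩ k).unop
  have hUW : U * W = P := by
    refine Matrix.ext fun i j => ?_
    have h := congrArg (fun v : V => (v : Fin n → ℍ[ℝ]) i) (b.sum_repr ⟨P.col j, hcol j⟩)
    simp only [Submodule.coe_sum, Submodule.coe_smul, Finset.sum_apply, Pi.smul_apply] at h
    rw [Matrix.mul_apply]
    exact h
  have hPU : P * U = U := by
    refine Matrix.ext fun i k => ?_
    obtain ⟨w, hw⟩ := mem_colSpan_iff.1 (b k).2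
    have h : P *ᵥ (b k : Fin n → ℍ[ℝ]) = b k := by rw [← hw, Matrix.mulVec_mulVec, hP]
    exact congrFun h i
  have hWU : W * U = 1 := by
    refine Matrix.ext fun k l => ?_
    have hz : U * (W * U - 1) = 0 := by
      rw [Matrix.mul_sub, ← Matrix.mul_assoc, hUW, hPU, Matrix.mul_one, sub_self]
    have hli := Fintype.linearIndependent_iff.1 b.linearIndependent
      (fun k => MulOpposite.op ((W * U - 1 : Matrix _ _ ℍ[ℝ]) k l)) (Subtype.ext (funext fun i => by
        have h := congrFun (congrFun hz i) l
        rw [Matrix.mul_apply] at h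
        simp only [Submodule.coe_sum, Submodule.coe_smul, Finset.sum_apply, Pi.smul_apply]
        exact h)) k
    exact sub_eq_zero.1 ((MulOpposite.op_eq_zero_iff _).1 hli)
  have htr : P.trace.re = (W * U).trace.re := by
    rw [← hUW]
    simp only [Matrix.trace, Matrix.diag_apply, Matrix.mul_apply, re_sum]
    rw [Finset.sum_comm]
    exact Finset.sum_congr rfl fun k _ => Finset.sum_congr rfl fun i _ => re_mul_comm _ _
  rw [htr, hWU, Matrix.trace_one, Fintype.card_fin, Quaternion.re_natCast]

end Rank

/-! ### The group inverse and its determinantal representation -/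

section GroupInverse

variable {n : ℕ}

theorem isGroupInverse_iff {A X : Matrix (Fin n) (Fin n) ℍ[ℝ]} (hind : ind A = 1) :
    IsGroupInverse A X ↔ A * A * X = A ∧ X * A * X = X ∧ A * X = X * A := by
  constructor
  · rintro ⟨-, h1, h2, h3⟩
    rw [hind, pow_one, one_add_one_eq_two, sq] at h1
    exact ⟨h1, h2, h3⟩
  · rintro ⟨h1, h2, h3⟩
    refine ⟨hind, ?_, h2, h3⟩
    rw [hind, pow_one, one_add_one_eq_two, sq]
    exact h1

theorem IsGroupInverse.unique {A X Y : Matrix (Fin n) (Fin n) ℍ[ℝ]} (hX : IsGroupInverse A X)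
    (hY : IsGroupInverse A Y) : X = Y := by
  obtain ⟨x1, x2, x3⟩ := (isGroupInverse_iff hX.1).1 hX
  obtain ⟨y1, y2, y3⟩ := (isGroupInverse_iff hX.1).1 hY
  have hXA : X * A * A = A := by rw [← x3, mul_assoc, ← x3, ← mul_assoc, x1]
  have h : X * A = Y * A := by
    calc X * A = X * A * A * Y := by rw [mul_assoc X A A, mul_assoc, y1]
      _ = Y * A := by rw [hXA, y3]
  calc X = X * A * X := x2.symm
    _ = Y * (A * X) := by rw [h, mul_assoc]
    _ = Y * A * Y := by rw [x3, h, mul_assoc, y3]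
    _ = Y := y2

/-- A Hermitian matrix whose square has the same rank has a Hermitian group inverse. -/
theorem exists_groupInverse {A : Matrix (Fin n) (Fin n) ℍ[ℝ]} (hA : A.IsHermitian)
    (hr : qrank (A ^ 2) = qrank A) : ∃ G : Matrix (Fin n) (Fin n) ℍ[ℝ],
      G.IsHermitian ∧ A * A * G = A ∧ G * A * G = G ∧ A * G = G * A := by
  have hfin : Module.Finite ℍ[ℝ]ᵐᵒᵖ (colSpan A) :=
    FiniteDimensional.span_of_finite _ (Set.finite_range _)
  have hspan : colSpan (A * A) = colSpan A :=
    Submodule.eq_of_le_of_finrank_eq (colSpan_mul_le A A) (by rw [← sq]; exact hr)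
  obtain ⟨X, hX⟩ := exists_mul_eq_of_colSpan_le hspan.ge
  have hY : Xᴴ * A * A = A := by
    have h := congrArg Matrix.conjTranspose hX
    rwa [Matrix.conjTranspose_mul, Matrix.conjTranspose_mul, hA.eq, ← mul_assoc] at h
  have hc : Xᴴ * A = A * X := by
    conv_lhs => rw [← hX, mul_assoc A A X, ← mul_assoc, ← mul_assoc, hY]
  have hAG : A * (Xᴴ * A * X) = A * X := by
    rw [hc, mul_assoc A X X, ← mul_assoc, ← mul_assoc, hX]
  have hGA : Xᴴ * A * X * A = A * X := by
    rw [mul_assoc Xᴴ A X, ← hc, ← mul_assoc, mul_assoc, mul_assoc, ← mul_assoc Xᴴ A A, hY]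
  refine ⟨Xᴴ * A * X, Matrix.isHermitian_conjTranspose_mul_mul X hA, ?_, ?_, hAG.trans hGA.symm⟩
  · rw [mul_assoc, hAG, ← mul_assoc, hX]
  · rw [hGA, ← hc, mul_assoc Xᴴ A, hAG, ← mul_assoc]

theorem qrank_mul_groupInverse {A G : Matrix (Fin n) (Fin n) ℍ[ℝ]} (h1 : A * A * G = A)
    (h3 : A * G = G * A) : qrank (A * G) = qrank A := by
  have h : colSpan (A * G) = colSpan A := by
    refine le_antisymm (colSpan_mul_le A G) ?_
    have h' := colSpan_mul_le (A * G) A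
    rwa [mul_assoc, ← h3, ← mul_assoc, h1] at h'
  rw [qrank_eq_finrank_colSpan, qrank_eq_finrank_colSpan, h]

theorem sumPrincipalMinors_eq {B : Matrix (Fin n) (Fin n) ℍ[ℝ]} (hB : B.IsHermitian) (r : ℕ) :
    sumPrincipalMinors r B = (minorSum B r : ℍ[ℝ]) := by
  rw [sumPrincipalMinors, minorSum, coe_sum,
    Finset.sum_subtype (p := fun β : Finset (Fin n) => β.card = r) _
      fun β => Finset.mem_powersetCard_univ]
  exact Finset.sum_congr rfl fun β _ => hdet_principal hB β.1

theorem sumCdet_updateCol {B : Matrix (Fin n) (Fin n) ℍ[ℝ]} (hB : B.IsHermitian) (r : ℕ)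
    (i j : Fin n) (A : Matrix (Fin n) (Fin n) ℍ[ℝ]) :
    sumCdet r i (B.updateCol i (A.col j)) = (cofactorSum B r * A) i j := by
  rw [sumCdet, cofactorSum_mul_apply, ← Finset.sum_filter,
    Finset.sum_subtype (p := fun β : Finset (Fin n) => β.card = r ∧ i ∈ β) _ fun β => by
      rw [Finset.mem_filter, Finset.mem_powersetCard_univ]]
  exact Finset.sum_congr rfl fun β _ => cdet_principal_updateCol hB β.2.2 (A.col j)

theorem sumRdet_updateRow {A B : Matrix (Fin n) (Fin n) ℍ[ℝ]} (hA : A.IsHermitian)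
    (hB : B.IsHermitian) (r : ℕ) (i j : Fin n) :
    sumRdet r j (B.updateRow j (A.row i)) = star (sumCdet r j (B.updateCol j (A.col i))) := by
  have h : (B.updateRow j (A.row i))ᴴ = B.updateCol j (A.col i) := by
    rw [← Matrix.updateCol_conjTranspose, hB.eq]
    congr 1
    ext k : 1
    exact hA.apply k i
  rw [sumRdet, sumCdet, star_sum, ← h]
  exact Finset.sum_congr rfl fun α _ => rdet_eq_star_cdet _ _

end GroupInverse

end QuatDet

theorem corollary3p1 {n : ℕ} (A : Matrix (Fin n) (Fin n) ℍ[ℝ]) (r : ℕ)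
    (hA : A.IsHermitian) (hind : QuatDet.ind A = 1)
    (hr2 : QuatDet.qrank (A ^ 2) = r) (hr : QuatDet.qrank A = r) :
    ∃ G : Matrix (Fin n) (Fin n) ℍ[ℝ],
      QuatDet.IsGroupInverse A G ∧
      (∀ X : Matrix (Fin n) (Fin n) ℍ[ℝ], QuatDet.IsGroupInverse A X → X = G) ∧
      (∃ d : ℝ, d ≠ 0 ∧ QuatDet.sumPrincipalMinors r (A ^ 2) = (d : ℍ[ℝ])) ∧
      (∀ i j : Fin n,
        G i j = QuatDet.sumCdet r i ((A ^ 2).updateCol i (A.col j)) /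
          QuatDet.sumPrincipalMinors r (A ^ 2)) ∧
      (∀ i j : Fin n,
        G i j = QuatDet.sumRdet r j ((A ^ 2).updateRow j (A.row i)) /
          QuatDet.sumPrincipalMinors r (A ^ 2)) := by
  obtain ⟨G, hG, h1, h2, h3⟩ := QuatDet.exists_groupInverse hA (hr2.trans hr.symm)
  have hB : (A ^ 2).IsHermitian := hA.pow 2
  have hP : A * G * (A * G) = A * G := by rw [mul_assoc, ← mul_assoc G, h2]
  have htr : (A * G).trace.re = r := by
    rw [QuatDet.re_trace_of_idempotent hP, QuatDet.qrank_mul_groupInverse h1 h3, hr]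
  obtain ⟨hd, hC⟩ := QuatDet.cofactorSum_mul_eq_smul hA h1 h2 h3 htr
  have hd' : (QuatDet.minorSum (A ^ 2) r : ℍ[ℝ]) ≠ 0 := fun h =>
    hd (Quaternion.coe_injective (h.trans Quaternion.coe_zero.symm))
  have hcol : ∀ i j, QuatDet.sumCdet r i ((A ^ 2).updateCol i (A.col j)) =
      G i j * (QuatDet.minorSum (A ^ 2) r : ℍ[ℝ]) := fun i j => by
    rw [QuatDet.sumCdet_updateCol hB, hC, Matrix.smul_apply, Quaternion.mul_coe_eq_smul]
  have hGI : QuatDet.IsGroupInverse A G := (QuatDet.isGroupInverse_iff hind).2 ⟨h1, h2, h3⟩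
  refine ⟨G, hGI, fun X hX => hX.unique hGI, ⟨_, hd, QuatDet.sumPrincipalMinors_eq hB r⟩,
    fun i j => ?_, fun i j => ?_⟩
  · rw [QuatDet.sumPrincipalMinors_eq hB, hcol, mul_div_cancel_right₀ _ hd']
  · rw [QuatDet.sumPrincipalMinors_eq hB, QuatDet.sumRdet_updateRow hA hB, hcol, star_mul,
      Quaternion.star_coe, hG.apply, Quaternion.coe_commutes, mul_div_cancel_right₀ _ hd']
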